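/- Let $a,b\in\mathbb{Q}^*$ be multiplicatively independent, i.e. $a^xb^y=1$ with $x,y\in\mathbb{Z}$ implies $x=y=0$. Then the torsion subgroup of $\mathbb{Q}^*/\langle -1,a,b\rangle$ is finite; let $t$ be its order. For all integers $i,j\ge 1$, let $\zeta_{ij}\in\mathbb{C}$ be a primitive $ij$-th root of unity and let $a^{1/ij},b^{1/i}\in\mathbb{C}$ be any $ij$-th root of $a$ and any $i$-th root of $b$. Then the quantity $$f_{i,j}=\frac{i^2j\,\varphi(ij)}{[\mathbb{Q}(\zeta_{ij},a^{1/ij},b^{1/i}):\mathbb{Q}]}$$ is a positive integer dividing $4t$. For $x\in\mathbb{Q}^*$ let $\Delta(x)\in\mathbb{Z}$ denote the discriminant of the field $\mathbb{Q}(\sqrt{x})$. If $t=1$, then - for $i$ even, $f_{i,j}$ is the number of elements of the set $\{1,\Delta(a),\Delta(b),\Delta(ab)\}$ that divide $ij$; - for $i$ odd, $f_{i,j}$ is the number of elements of the set $\{1,\operatorname{lcm}(2,\Delta(a))\}$ that divide $ij$. -/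

import Mathlib

namespace RadicalDegree

/-- Two nonzero rational numbers are multiplicatively independent if they satisfy no
nontrivial relation `a ^ x * b ^ y = 1` with integer exponents. -/
def MultIndep (a b : ℚˣ) : Prop :=
  ∀ x y : ℤ, a ^ x * b ^ y = 1 → x = 0 ∧ y = 0

/-- The factor group `ℚˣ / ⟨-1, a, b⟩`. -/
abbrev FactorGroup (a b : ℚˣ) : Type :=
  ℚˣ ⧸ Subgroup.closure ({-1, a, b} : Set ℚˣ)

/-- The torsion subgroup of `ℚˣ / ⟨-1, a, b⟩`. -/
abbrev torsionSubgroup (a b : ℚˣ) : Subgroup (FactorGroup a b) :=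
  CommGroup.torsion (FactorGroup a b)

/-- The order of the torsion subgroup of `ℚˣ / ⟨-1, a, b⟩`. -/
noncomputable def torsionOrder (a b : ℚˣ) : ℕ :=
  Nat.card (torsionSubgroup a b)

/-- The field `ℚ(√x)`, as a subfield of `ℂ`. -/
noncomputable abbrev sqrtField (x : ℚˣ) : IntermediateField ℚ ℂ :=
  IntermediateField.adjoin ℚ {z : ℂ | z ^ 2 = ((x : ℚ) : ℂ)}

theorem sqrtField_finiteDimensional (x : ℚˣ) : FiniteDimensional ℚ (sqrtField x) := by
  have key : {z : ℂ | z ^ 2 = ((x : ℚ) : ℂ)}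
      = ↑((Polynomial.nthRoots 2 ((x : ℚ) : ℂ)).toFinset) := by
    ext z
    simp [Polynomial.mem_nthRoots]
  have hfin : Finite {z : ℂ | z ^ 2 = ((x : ℚ) : ℂ)} := by
    rw [key]
    exact Finset.finite_toSet _
  refine IntermediateField.finiteDimensional_adjoin (fun z hz => ?_)
  refine IsIntegral.of_pow (n := 2) (by norm_num) ?_
  rw [show z ^ 2 = algebraMap ℚ ℂ (x : ℚ) from hz]
  exact isIntegral_algebraMap

instance sqrtField_numberField (x : ℚˣ) : NumberField (sqrtField x) where
  to_charZero := inferInstance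
  to_finiteDimensional := sqrtField_finiteDimensional x

/-- The discriminant `Δ(x)` of the field `ℚ(√x)`. -/
noncomputable def quadDisc (x : ℚˣ) : ℤ :=
  NumberField.discr (sqrtField x)

/-- The rational number `i² j φ(ij) / [ℚ(ζ, α, β) : ℚ]`, to be used with `ζ` a primitive
`ij`-th root of unity, `α` an `ij`-th root of `a` and `β` an `i`-th root of `b`. -/
noncomputable def degreeLoss (i j : ℕ) (ζ α β : ℂ) : ℚ :=
  ((i ^ 2 * j * Nat.totient (i * j) : ℕ) : ℚ) /
    (Module.finrank ℚ (IntermediateField.adjoin ℚ ({ζ, α, β} : Set ℂ)) : ℚ)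

end RadicalDegree

/-! ### Square classes of rationals and squares modulo 4 -/

section

open Polynomial

/-! Put `n = i * j` and `K = ℚ(ζ)`. Since `K` contains the `n`-th roots of unity, Kummer theory
gives `[K(α, β) : K] = n * i / N`, where `N` counts the pairs `(x, y)` modulo `(n, i)` with `αˣ βʸ ∈
K`. As `[K : ℚ] = φ(n)`, the quantity `f` is exactly `N` (`degreeLoss_eq_card_cycExponents`).

These pairs form a subgroup `H` of `ℤ/n × ℤ/i`. A monomial `c = αˣ βʸ` in `K` has a rational power,
so all conjugates of `c` have the same absolute value; as `K` is abelian, `|c|²` is rational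
(`exists_normSq_eq_ratCast`). Its `n`-th power is `a²ˣ b²ʲʸ`, so sending `(x, y)` to the class of
`|c|²` maps `H` to the torsion of `ℚˣ / ⟨-1, a, b⟩`. If that class is trivial, independence of `a,
b` forces `n ∣ 2x` and `i ∣ 2y`, so the kernel is 2-torsion and its order divides 4. Hence `N ∣ 4t`
(`card_cycExponents_dvd`). The torsion group is finite because it comes from rationals supported on
the primes of `a` and `b`.

If `t = 1`, all of `H` is 2-torsion, and the candidate monomials are square roots of `1, a, b, ab`.
Such a root lies in `K` exactly when the discriminant of the quadratic field divides `n`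
(`hasCycSqrt_iff_quadDisc_dvd`): Gauss sums supply the roots, ramification and the roots of unity of
`K` exclude the others. The discriminants are distinct because `t = 1` leaves `a`, `b`, `ab` in
distinct nontrivial square classes. -/

theorem Rat.exists_squarefree_mul_sq (x : ℚˣ) :
    ∃ (d : ℤ) (q : ℚ), Squarefree d ∧ q ≠ 0 ∧ (x : ℚ) = d * q ^ 2 := by
  have hx : (x : ℚ) ≠ 0 := x.ne_zero
  obtain ⟨u, v, hu, hv, huv, hsq⟩ := Nat.sq_mul_squarefree_of_pos
    (n := (x : ℚ).num.natAbs * (x : ℚ).den)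
    (by have := Rat.num_ne_zero.2 hx; have := (x : ℚ).den_pos; positivity)
  have hden : ((x : ℚ).den : ℚ) ≠ 0 := by exact_mod_cast (x : ℚ).den_ne_zero
  have h1 : ((x : ℚ).num.natAbs : ℚ) * (x : ℚ).den = v ^ 2 * u := by exact_mod_cast huv.symm
  refine ⟨(x : ℚ).num.sign * u, v / (x : ℚ).den, ?_, ?_, ?_⟩
  · rw [← Int.squarefree_natAbs, Int.natAbs_mul, Int.natAbs_sign_of_ne_zero (Rat.num_ne_zero.2 hx)]
    simpa using hsq
  · have : (v : ℚ) ≠ 0 := by positivity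
    positivity
  · have h2 : ((x : ℚ).num : ℚ) = ((x : ℚ).num.sign : ℚ) * (x : ℚ).num.natAbs := by
      
      conv_lhs => rw [← Int.sign_mul_natAbs (x : ℚ).num]
      rw [Int.cast_mul, Int.cast_natCast]
    have h3 : (x : ℚ) * (x : ℚ).den = (x : ℚ).num := Rat.mul_den_eq_num _
    push_cast
    field_simp
    rw [pow_two, ← mul_assoc, h3, h2, mul_assoc, h1]
    ring

/-- The product `y * d` has integral square `m * d`, hence is an integer; squarefreeness of `d` then
allows `d` to be divided out. -/
theorem Rat.exists_int_eq_of_squarefree_mul_sq {d m : ℤ} (hd : Squarefree d) {y : ℚ}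
    (h : y ^ 2 * d = m) : ∃ z : ℤ, y = z := by
  have hd0 : (d : ℚ) ≠ 0 := by exact_mod_cast hd.ne_zero
  have hint : IsIntegral ℤ (y * d) := by
    refine IsIntegral.of_pow (n := 2) two_pos ?_
    have : (y * d) ^ 2 = ((m * d : ℤ) : ℚ) := by push_cast; rw [← h]; ring
    rw [this]
    exact isIntegral_algebraMap (R := ℤ) (x := m * d)
  obtain ⟨z, hz⟩ := IsIntegrallyClosed.isIntegral_iff.1 hint
  have hz : (z : ℚ) = y * d := hz
  have h1 : z ^ 2 = m * d := by
    have : ((z ^ 2 : ℤ) : ℚ) = ((m * d : ℤ) : ℚ) := by push_cast; rw [← h, hz]; ring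
    exact_mod_cast this
  have h2 : d ∣ z := (hd.dvd_pow_iff_dvd two_ne_zero).1
    ⟨m, by rw [h1]; ring⟩
  obtain ⟨w, rfl⟩ := h2
  refine ⟨w, ?_⟩
  push_cast at hz
  exact mul_right_cancel₀ hd0 (by rw [← hz]; ring)

/-- Squares are 0 or 1 modulo 4, and a squarefree `d` is not 0. The hypothesis expresses that `(x +
y√d) / 2` has integral norm; the conclusion separates the two shapes of the ring of integers. -/
theorem Int.sq_sub_mul_sq_emod_four {d x y : ℤ} (hd : Squarefree d) (h : (4 : ℤ) ∣ x ^ 2 - d * y ^ 2) :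
    (d % 4 = 1 → Even (x - y)) ∧ (d % 4 ≠ 1 → Even x ∧ Even y) := by
  have h4 : ¬ (4 : ℤ) ∣ d := fun h4 => by
    have := hd 2 (by simpa using h4)
    exact absurd (Int.isUnit_iff.1 this) (by norm_num)
  have hx : x ^ 2 % 4 = 0 ∧ Even x ∨ x ^ 2 % 4 = 1 ∧ Odd x := by
    rcases Int.even_or_odd x with h | h
    · left; refine ⟨?_, h⟩; obtain ⟨k, rfl⟩ := h; ring_nf; omega
    · right; refine ⟨?_, h⟩; obtain ⟨k, rfl⟩ := h; ring_nf; omega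
  have hy : y ^ 2 % 4 = 0 ∧ Even y ∨ y ^ 2 % 4 = 1 ∧ Odd y := by
    rcases Int.even_or_odd y with h | h
    · left; refine ⟨?_, h⟩; obtain ⟨k, rfl⟩ := h; ring_nf; omega
    · right; refine ⟨?_, h⟩; obtain ⟨k, rfl⟩ := h; ring_nf; omega
  have hm : (d * y ^ 2) % 4 = ((d % 4) * (y ^ 2 % 4)) % 4 := Int.mul_emod _ _ _
  have hd4 : d % 4 = 1 ∨ d % 4 = 2 ∨ d % 4 = 3 := by omega
  have key : (d % 4 = 1 → (Even x ∧ Even y ∨ Odd x ∧ Odd y)) ∧ (d % 4 ≠ 1 → Even x ∧ Even y) := by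
    rcases hx with ⟨hx, hx'⟩ | ⟨hx, hx'⟩ <;> rcases hy with ⟨hy, hy'⟩ | ⟨hy, hy'⟩ <;>
    rcases hd4 with e | e | e <;> rw [hy, e] at hm <;> norm_num at hm <;> first
      | (exfalso; omega)
      | simp [*]
  refine ⟨fun h => ?_, key.2⟩
  rcases key.1 h with h | h
  · exact h.1.sub h.2
  · exact h.1.sub_odd h.2

/-! ### Discriminants of quadratic fields -/

section Quadratic

variable {K : Type*} [Field K] [NumberField K] {d : ℤ} {s : K}

theorem linearIndependent_one_sqrt (hd : Squarefree d) (hd1 : d ≠ 1) (hs : s ^ 2 = d) :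
    LinearIndependent ℚ ![(1 : K), s] := by
  rw [LinearIndependent.pair_iff]
  intro u v h
  simp only [Algebra.smul_def, mul_one] at h
  have hv : v = 0 := by
    by_contra hv
    have h1 : algebraMap ℚ K (u ^ 2) = algebraMap ℚ K (v ^ 2 * d) := by
      have : algebraMap ℚ K u = - (algebraMap ℚ K v * s) := by linear_combination h
      push_cast [map_pow, map_mul, this]
      rw [neg_sq, mul_pow, hs]
      simp
    have h2 : u ^ 2 = v ^ 2 * d := (algebraMap ℚ K).injective h1
    -- A relation makes `d` a rational square; inverting the ratio makes its product with `d` the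
    -- integer 1, so `v / u` is itself an integer and `d` is a unit.
    have h3 : (1 / (u / v) : ℚ) ^ 2 * d = 1 := by
      have hu : u ≠ 0 := by
        rintro rfl
        have : (d : ℚ) ≠ 0 := by exact_mod_cast hd.ne_zero
        apply mul_ne_zero (pow_ne_zero 2 hv) this
        rw [← h2]; simp
      field_simp
      rw [h2]
    obtain ⟨z, hz⟩ := Rat.exists_int_eq_of_squarefree_mul_sq (m := 1) hd (by rw [h3]; simp)
    rw [hz] at h3
    have h4 : z ^ 2 * d = 1 := by exact_mod_cast h3
    apply hd1
    rcases Int.isUnit_iff.1 (IsUnit.of_mul_eq_one (z ^ 2) (by rw [mul_comm]; exact h4)) with h | h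
    · exact h
    · rw [h] at h4; nlinarith [sq_nonneg z]
  subst hv
  simpa using h

/-- The basis `1, s` of a quadratic field. -/
noncomputable def sqrtBasis (hd : Squarefree d) (hd1 : d ≠ 1) (hs : s ^ 2 = d)
    (h2 : Module.finrank ℚ K = 2) : Module.Basis (Fin 2) ℚ K :=
  basisOfLinearIndependentOfCardEqFinrank (linearIndependent_one_sqrt hd hd1 hs) (by simp [h2])

theorem coe_sqrtBasis (hd : Squarefree d) (hd1 : d ≠ 1) (hs : s ^ 2 = d)
    (h2 : Module.finrank ℚ K = 2) : ⇑(sqrtBasis hd hd1 hs h2) = ![1, s] := by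
  simp [sqrtBasis]

theorem trace_sqrt_eq_zero (hd : Squarefree d) (hd1 : d ≠ 1) (hs : s ^ 2 = d)
    (h2 : Module.finrank ℚ K = 2) : Algebra.trace ℚ K s = 0 := by
  have hb := coe_sqrtBasis hd hd1 hs h2
  set b := sqrtBasis hd hd1 hs h2
  have b0 : b 0 = 1 := by rw [hb]; rfl
  have b1 : b 1 = s := by rw [hb]; rfl
  have e0 : s * b 0 = b 1 := by rw [b0, b1, mul_one]
  have e1 : s * b 1 = (d : ℚ) • b 0 := by rw [b0, b1, ← sq, hs, Algebra.smul_def]; simp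
  rw [Algebra.trace_eq_matrix_trace b, Matrix.trace_fin_two, Algebra.leftMulMatrix_eq_repr_mul,
    Algebra.leftMulMatrix_eq_repr_mul, e0, e1]
  simp

theorem exists_eq_add_mul_sqrt (hd : Squarefree d) (hd1 : d ≠ 1) (hs : s ^ 2 = d)
    (h2 : Module.finrank ℚ K = 2) (w : K) : ∃ u v : ℚ, w = u + v * s := by
  have hb := coe_sqrtBasis hd hd1 hs h2
  set b := sqrtBasis hd hd1 hs h2
  refine ⟨b.repr w 0, b.repr w 1, ?_⟩
  conv_lhs => rw [← b.sum_repr w, Fin.sum_univ_two]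
  simp [hb, Algebra.smul_def]

/-- For `w = u + v * s`, the trace gives the integer `x = 2u` and the norm `w * (x - w)` an integer
`m`. Then `(2v)² * d = x² - 4m` is integral, so `2v` is an integer as `d` is squarefree. -/
theorem exists_two_mul_eq_of_isIntegral (hd : Squarefree d) (hd1 : d ≠ 1) (hs : s ^ 2 = d)
    (h2 : Module.finrank ℚ K = 2) {w : K} (hw : IsIntegral ℤ w) :
    ∃ x y : ℤ, 2 * w = x + y * s ∧ (4 : ℤ) ∣ x ^ 2 - d * y ^ 2 := by
  obtain ⟨u, v, rfl⟩ := exists_eq_add_mul_sqrt hd hd1 hs h2 w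
  have htr : Algebra.trace ℚ K (u + v * s) = 2 * u := by
    have h1 : (u : K) = algebraMap ℚ K u := by simp
    have h3 : (v : K) * s = v • s := by simp [Algebra.smul_def]
    rw [map_add, h3, map_smul, trace_sqrt_eq_zero hd hd1 hs h2, h1, Algebra.trace_algebraMap, h2]
    simp
  obtain ⟨x, hx⟩ := IsIntegrallyClosed.isIntegral_iff.1 (Algebra.isIntegral_trace (L := ℚ) hw)
  rw [htr] at hx
  have hx : (x : ℚ) = 2 * u := hx
  have hxK : (x : K) = 2 * u := by
    have := congrArg (algebraMap ℚ K) hx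
    simpa using this
  have hn : IsIntegral ℤ (algebraMap ℚ K (u ^ 2 - d * v ^ 2)) := by
    have : algebraMap ℚ K (u ^ 2 - d * v ^ 2) = (u + v * s) * (x - (u + v * s)) := by
      rw [hxK]; simp; rw [← hs]; ring
    rw [this]
    exact hw.mul ((isIntegral_algebraMap (R := ℤ) (x := x)).sub hw)
  rw [isIntegral_algebraMap_iff (algebraMap ℚ K).injective] at hn
  obtain ⟨m, hm⟩ := IsIntegrallyClosed.isIntegral_iff.1 hn
  have hm : (m : ℚ) = u ^ 2 - d * v ^ 2 := hm
  obtain ⟨y, hy⟩ := Rat.exists_int_eq_of_squarefree_mul_sq (m := x ^ 2 - 4 * m) (y := 2 * v) hd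
    (by push_cast; rw [hm, hx]; ring)
  have hyK : (y : K) = 2 * v := by
    have := congrArg (algebraMap ℚ K) hy
    simpa using this.symm
  refine ⟨x, y, by rw [hxK, hyK]; ring, m, ?_⟩
  have : ((x ^ 2 - d * y ^ 2 : ℤ) : ℚ) = ((4 * m : ℤ) : ℚ) := by
    push_cast; rw [hm, hx, ← hy]; ring
  exact_mod_cast this

/-- The base changes between `b` and an integral basis are integral in both directions, so the
discriminants agree. -/
theorem discr_eq_of_repr_isIntegral {ι : Type*} [Fintype ι] [DecidableEq ι] (b : Module.Basis ι ℚ K)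
    (hb : ∀ i, IsIntegral ℤ (b i)) (hr : ∀ w : K, IsIntegral ℤ w → ∀ i, IsIntegral ℤ (b.repr w i)) :
    (NumberField.discr K : ℚ) = Algebra.discr ℚ b := by
  rw [NumberField.coe_discr]
  refine Algebra.discr_eq_discr_of_toMatrix_coeff_isIntegral K (fun i j => ?_) (fun i j => ?_)
  · obtain ⟨w, hw⟩ : ∃ w : NumberField.RingOfIntegers K, algebraMap _ K w = b j := ⟨⟨b j, hb j⟩, rfl⟩
    rw [Module.Basis.toMatrix_apply, ← hw, NumberField.integralBasis_repr_apply]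
    exact isIntegral_algebraMap
  · rw [Module.Basis.toMatrix_apply]
    refine hr _ ?_ _
    rw [NumberField.integralBasis_apply]
    exact NumberField.RingOfIntegers.isIntegral_coe _

theorem Module.Basis.repr_fin_two {F V : Type*} [Field F] [AddCommGroup V] [Module F V]
    (b : Module.Basis (Fin 2) F V) {w : V} {x y : F} (h : w = x • b 0 + y • b 1) :
    b.repr w 0 = x ∧ b.repr w 1 = y := by
  subst h
  simp

theorem discr_quadratic_of_emod_four_ne_one (hd : Squarefree d) (hd4 : d % 4 ≠ 1) (hs : s ^ 2 = d)
    (h2 : Module.finrank ℚ K = 2) : NumberField.discr K = 4 * d := by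
  have hd1 : d ≠ 1 := by rintro rfl; exact hd4 rfl
  have hb := coe_sqrtBasis hd hd1 hs h2
  have hsint : IsIntegral ℤ s := IsIntegral.of_pow two_pos
    (by rw [hs]; exact isIntegral_algebraMap (R := ℤ) (x := d))
  have key := discr_eq_of_repr_isIntegral (sqrtBasis hd hd1 hs h2) ?_ ?_
  · have hss : s * s = algebraMap ℚ K d := by rw [← sq, hs]; simp
    have h1 : Algebra.trace ℚ K 1 = 2 := by
      rw [← map_one (algebraMap ℚ K), Algebra.trace_algebraMap, h2]; simp
    have h3 : Algebra.discr ℚ (sqrtBasis hd hd1 hs h2) = 4 * d := by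
      rw [hb, Algebra.discr_def, Matrix.det_fin_two]
      simp only [Algebra.traceMatrix_apply, Algebra.traceForm_apply, Matrix.cons_val_zero,
        Matrix.cons_val_one, one_mul, mul_one]
      rw [trace_sqrt_eq_zero hd hd1 hs h2, h1, hss, Algebra.trace_algebraMap, h2]
      simp only [nsmul_eq_mul]; push_cast; ring
    rw [h3] at key
    exact_mod_cast key
  · rw [hb]
    intro i
    fin_cases i
    · exact isIntegral_one
    · exact hsint
  · intro w hw
    obtain ⟨x, y, hxy, h4⟩ := exists_two_mul_eq_of_isIntegral hd hd1 hs h2 hw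
    obtain ⟨⟨x', rfl⟩, y', rfl⟩ := (Int.sq_sub_mul_sq_emod_four hd h4).2 hd4
    obtain ⟨h0, h1⟩ := (sqrtBasis hd hd1 hs h2).repr_fin_two (w := w) (x := x') (y := y') (by
      rw [hb]
      simp only [Matrix.cons_val_zero, Matrix.cons_val_one, Algebra.smul_def, mul_one]
      apply mul_left_cancel₀ (two_ne_zero (α := K))
      rw [hxy]; simp; ring)
    intro i
    fin_cases i
    · exact h0 ▸ isIntegral_algebraMap (R := ℤ) (x := x')
    · exact h1 ▸ isIntegral_algebraMap (R := ℤ) (x := y')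

theorem discr_quadratic_of_emod_four_eq_one (hd : Squarefree d) (hd1 : d ≠ 1) (hd4 : d % 4 = 1)
    (hs : s ^ 2 = d) (h2 : Module.finrank ℚ K = 2) : NumberField.discr K = d := by
  have hli : LinearIndependent ℚ ![(1 : K), (1 + s) / 2] := by
    have h := linearIndependent_one_sqrt hd hd1 hs
    rw [LinearIndependent.pair_iff] at h ⊢
    intro u v huv
    obtain ⟨h3, h4⟩ := h (u + v / 2) (v / 2) (by
      rw [← huv]
      simp only [Algebra.smul_def, map_add, map_div₀, map_ofNat]
      ring)
    have hv : v = 0 := by linarith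
    exact ⟨by rw [hv] at h3; linarith, hv⟩
  set b := basisOfLinearIndependentOfCardEqFinrank hli (by simp [h2]) with hbdef
  have hb : ⇑b = ![(1 : K), (1 + s) / 2] := by simp [hbdef]
  have key := discr_eq_of_repr_isIntegral b ?_ ?_
  · have h1 : Algebra.trace ℚ K 1 = 2 := by
      rw [← map_one (algebraMap ℚ K), Algebra.trace_algebraMap, h2]; simp
    have ht : Algebra.trace ℚ K ((1 + s) / 2) = 1 := by
      have : (1 + s) / 2 = (1 / 2 : ℚ) • ((1 : K) + s) := by
        rw [Algebra.smul_def]; simp; ring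
      rw [this, map_smul, map_add, h1, trace_sqrt_eq_zero hd hd1 hs h2]; norm_num
    have htt : Algebra.trace ℚ K ((1 + s) / 2 * ((1 + s) / 2)) = (1 + d) / 2 := by
      have : (1 + s) / 2 * ((1 + s) / 2) =
          ((1 + d) / 4 : ℚ) • (1 : K) + (1 / 2 : ℚ) • s := by
        rw [Algebra.smul_def, Algebra.smul_def]; simp; rw [← hs]; ring
      rw [this, map_add, map_smul, map_smul, h1, trace_sqrt_eq_zero hd hd1 hs h2]
      simp only [smul_eq_mul]; ring
    have h3 : Algebra.discr ℚ b = d := by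
      rw [hb, Algebra.discr_def, Matrix.det_fin_two]
      simp only [Algebra.traceMatrix_apply, Algebra.traceForm_apply, Matrix.cons_val_zero,
        Matrix.cons_val_one, one_mul, mul_one]
      rw [h1, ht, htt]; ring
    rw [h3] at key
    exact_mod_cast key
  · rw [hb]
    obtain ⟨k, hk⟩ : ∃ k : ℤ, d = 4 * k + 1 := ⟨d / 4, by omega⟩
    intro i
    fin_cases i
    · exact isIntegral_one
    -- With `d = 4k + 1`, the element `(1 + s) / 2` is a root of `X² - X - k`.
    · refine ⟨X ^ 2 - X - C k, ?_, ?_⟩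
      · have : (X ^ 2 - X - C k : ℤ[X]) = X ^ 2 - (X + C k) := by ring
        rw [this]
        refine monic_X_pow_sub ?_
        rw [degree_X_add_C]; norm_num
      · simp only [eval₂_sub, eval₂_X_pow, eval₂_X, eval₂_C]
        have : s ^ 2 = 4 * k + 1 := by rw [hs, hk]; push_cast; ring
        simp
        linear_combination this / 4
  · intro w hw
    obtain ⟨x, y, hxy, h4⟩ := exists_two_mul_eq_of_isIntegral hd hd1 hs h2 hw
    obtain ⟨z, hz⟩ := (Int.sq_sub_mul_sq_emod_four hd h4).1 hd4
    -- Since `x` and `y` have the same parity, `w = z + y * (1 + s) / 2`.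
    obtain rfl : x = y + (z + z) := by omega
    obtain ⟨h0, h1⟩ := b.repr_fin_two (w := w) (x := z) (y := y) (by
      rw [hb]
      simp only [Matrix.cons_val_zero, Matrix.cons_val_one, Algebra.smul_def, mul_one]
      apply mul_left_cancel₀ (two_ne_zero (α := K))
      rw [hxy]; simp; ring)
    intro i
    fin_cases i
    · exact h0 ▸ isIntegral_algebraMap (R := ℤ) (x := z)
    · exact h1 ▸ isIntegral_algebraMap (R := ℤ) (x := y)

end Quadratic

/-! ### Square roots of rationals in cyclotomic fields -/

namespace RadicalDegree

theorem sqrtField_eq_adjoin {x : ℚˣ} {z : ℂ} (hz : z ^ 2 = ((x : ℚ) : ℂ)) :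
    sqrtField x = IntermediateField.adjoin ℚ {z} := by
  apply le_antisymm
  · rw [IntermediateField.adjoin_le_iff]
    intro w hw
    have hw : w ^ 2 = ((x : ℚ) : ℂ) := hw
    rw [← hz, sq_eq_sq_iff_eq_or_eq_neg] at hw
    have := IntermediateField.mem_adjoin_simple_self ℚ z
    rcases hw with rfl | rfl
    · exact this
    · exact neg_mem this
  · exact IntermediateField.adjoin.mono _ _ _ (by simpa using hz)

theorem exists_sq_eq_of_ratCast (x : ℚˣ) : ∃ z : ℂ, z ^ 2 = ((x : ℚ) : ℂ) :=
  IsAlgClosed.exists_pow_nat_eq _ two_pos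

theorem finrank_sqrtField {x : ℚˣ} (hx : ¬ IsSquare (x : ℚ)) :
    Module.finrank ℚ (sqrtField x) = 2 := by
  obtain ⟨z, hz⟩ := exists_sq_eq_of_ratCast x
  have hirr : Irreducible (X ^ 2 - C (x : ℚ)) := by
    refine X_pow_sub_C_irreducible_of_prime Nat.prime_two fun b hb => hx ⟨b, ?_⟩
    rw [← hb, sq]
  have hmin : minpoly ℚ z = X ^ 2 - C (x : ℚ) :=
    (minpoly.eq_of_irreducible_of_monic hirr (by simp [hz]) (monic_X_pow_sub_C _ two_ne_zero)).symm
  have hint : IsIntegral ℚ z := ⟨_, monic_X_pow_sub_C (x : ℚ) two_ne_zero, by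
    simp [hz]⟩
  rw [sqrtField_eq_adjoin hz, IntermediateField.adjoin.finrank hint, hmin, natDegree_X_pow_sub_C]

theorem exists_quadDisc_eq (x : ℚˣ) : ∃ (d : ℤ) (q : ℚ), Squarefree d ∧ q ≠ 0 ∧
    (x : ℚ) = d * q ^ 2 ∧ (d % 4 = 1 ∧ quadDisc x = d ∨ d % 4 ≠ 1 ∧ quadDisc x = 4 * d) := by
  obtain ⟨d, q, hd, hq, hx⟩ := Rat.exists_squarefree_mul_sq x
  refine ⟨d, q, hd, hq, hx, ?_⟩
  obtain ⟨z, hz⟩ := exists_sq_eq_of_ratCast x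
  have hzmem : z ∈ sqrtField x := IntermediateField.subset_adjoin _ _ hz
  -- When `x` is a square the field is `ℚ`, whose discriminant 1 fits the case `d % 4 = 1`.
  by_cases hd1 : d = 1
  · subst hd1
    left
    refine ⟨rfl, ?_⟩
    have h1 : sqrtField x = ⊥ := by
      rw [sqrtField_eq_adjoin (z := q) (by rw [hx]; simp), IntermediateField.adjoin_simple_eq_bot_iff]
      exact ⟨q, by simp⟩
    have e : sqrtField x ≃ₐ[ℚ] ℚ :=
      (IntermediateField.equivOfEq h1).trans (IntermediateField.botEquiv ℚ ℂ)
    rw [quadDisc, NumberField.discr_eq_discr_of_algEquiv _ e, Rat.numberField_discr]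
  · have hqC : (q : ℂ) ≠ 0 := by exact_mod_cast hq
    set s : sqrtField x := ⟨z, hzmem⟩ / (algebraMap ℚ (sqrtField x) q) with hsdef
    have hs : s ^ 2 = d := by
      apply Subtype.ext
      rw [hsdef]
      push_cast
      rw [div_pow]
      change z ^ 2 / (q : ℂ) ^ 2 = _
      rw [hz, hx]
      push_cast
      field_simp
    have h2 : Module.finrank ℚ (sqrtField x) = 2 := by
      refine finrank_sqrtField ?_
      rintro ⟨r, hr⟩
      obtain ⟨w, hw⟩ := Rat.exists_int_eq_of_squarefree_mul_sq (m := 1) (y := q / r) hd (by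
        have hr0 : r ≠ 0 := by rintro rfl; simp at hr
        rw [div_pow, sq r, ← hr, hx]
        have : (d : ℚ) ≠ 0 := by exact_mod_cast hd.ne_zero
        field_simp; simp)
      have hr0 : r ≠ 0 := by rintro rfl; simp at hr
      have h3 : w ^ 2 * d = 1 := by
        have : (w : ℚ) ^ 2 * d = 1 := by
          rw [← hw, div_pow, sq r, ← hr, hx]
          have : (d : ℚ) ≠ 0 := by exact_mod_cast hd.ne_zero
          field_simp
        exact_mod_cast this
      apply hd1
      rcases Int.isUnit_iff.1 (IsUnit.of_mul_eq_one (w ^ 2) (by rw [mul_comm]; exact h3)) with h | h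
      · exact h
      · rw [h] at h3; nlinarith [sq_nonneg w]
    by_cases hd4 : d % 4 = 1
    · exact Or.inl ⟨hd4, discr_quadratic_of_emod_four_eq_one hd hd1 hd4 hs h2⟩
    · exact Or.inr ⟨hd4, discr_quadratic_of_emod_four_ne_one hd hd4 hs h2⟩

/-- The `n`-th cyclotomic field, as a subfield of `ℂ`. -/
noncomputable def cycField (n : ℕ) : IntermediateField ℚ ℂ :=
  IntermediateField.adjoin ℚ {Complex.exp (2 * Real.pi * Complex.I / n)}

theorem cycField_eq_adjoin {n : ℕ} (hn : n ≠ 0) {ζ : ℂ} (hζ : IsPrimitiveRoot ζ n) :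
    cycField n = IntermediateField.adjoin ℚ {ζ} := by
  have : NeZero n := ⟨hn⟩
  have h1 := Complex.isPrimitiveRoot_exp n hn
  rw [cycField, ← IntermediateField.isCyclotomicExtension_singleton_iff_eq_adjoin n _ _ _ hζ,
    IntermediateField.isCyclotomicExtension_singleton_iff_eq_adjoin n _ _ _ h1]

instance isCyclotomicExtension_cycField (n : ℕ) [NeZero n] :
    IsCyclotomicExtension {n} ℚ (cycField n) :=
  (IntermediateField.isCyclotomicExtension_singleton_iff_eq_adjoin n _ _ _
    (Complex.isPrimitiveRoot_exp n (NeZero.ne n))).2 rfl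

instance numberField_cycField (n : ℕ) [NeZero n] : NumberField (cycField n) :=
  IsCyclotomicExtension.numberField {n} ℚ _

theorem mem_cycField_of_pow_eq_one {n : ℕ} (hn : n ≠ 0) {z : ℂ} (hz : z ^ n = 1) :
    z ∈ cycField n := by
  have : NeZero n := ⟨hn⟩
  obtain ⟨i, -, rfl⟩ := (Complex.isPrimitiveRoot_exp n hn).eq_pow_of_pow_eq_one hz
  exact pow_mem (IntermediateField.mem_adjoin_simple_self ℚ _) i

theorem cycField_mono {m n : ℕ} (hm : m ≠ 0) (hn : n ≠ 0) (h : m ∣ n) : cycField m ≤ cycField n := by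
  rw [cycField, IntermediateField.adjoin_simple_le_iff]
  obtain ⟨k, rfl⟩ := h
  apply mem_cycField_of_pow_eq_one hn
  rw [pow_mul, (Complex.isPrimitiveRoot_exp m hm).pow_eq_one, one_pow]

/-- The roots of unity of the field form a group of order `n` or `2 * n`. This is what excludes
`√-1` and `√2` when `n` has too few factors 2. -/
theorem dvd_of_isPrimitiveRoot_mem_cycField {l n : ℕ} (hl : l ≠ 0) (hn : n ≠ 0) {z : ℂ}
    (hz : IsPrimitiveRoot z l) (hzn : z ∈ cycField n) : l ∣ if Even n then n else 2 * n := by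
  have : NeZero n := ⟨hn⟩
  have : NeZero l := ⟨hl⟩
  rw [← IsCyclotomicExtension.Rat.torsionOrder_eq (n := n) (K := cycField n)]
  have : IsPrimitiveRoot (⟨z, hzn⟩ : cycField n) l := by
    rwa [← IsPrimitiveRoot.coe_submonoidClass_iff]
  exact NumberField.Units.dvd_torsionOrder_of_isPrimitiveRoot this

/-- The rationals whose square roots lie in the `n`-th cyclotomic field. -/
def HasCycSqrt (n : ℕ) (x : ℚ) : Prop := ∃ z ∈ cycField n, z ^ 2 = (x : ℂ)

namespace HasCycSqrt

variable {m n : ℕ} {x y : ℚ}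

theorem mono (hm : m ≠ 0) (hn : n ≠ 0) (h : m ∣ n) (hx : HasCycSqrt m x) : HasCycSqrt n x := by
  obtain ⟨z, hz, h1⟩ := hx
  exact ⟨z, cycField_mono hm hn h hz, h1⟩

theorem mul (hx : HasCycSqrt n x) (hy : HasCycSqrt n y) : HasCycSqrt n (x * y) := by
  obtain ⟨z, hz, h1⟩ := hx
  obtain ⟨w, hw, h2⟩ := hy
  exact ⟨z * w, mul_mem hz hw, by rw [mul_pow, h1, h2]; push_cast; rfl⟩

theorem inv (hx : HasCycSqrt n x) : HasCycSqrt n x⁻¹ := by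
  obtain ⟨z, hz, h1⟩ := hx
  exact ⟨z⁻¹, inv_mem hz, by rw [inv_pow, h1]; push_cast; rfl⟩

theorem sq (n : ℕ) (x : ℚ) : HasCycSqrt n (x ^ 2) :=
  ⟨x, (cycField n).algebraMap_mem x, by push_cast; rfl⟩

theorem one (n : ℕ) : HasCycSqrt n 1 := by simpa using sq n 1

theorem mul_sq_iff (hy : y ≠ 0) : HasCycSqrt n (x * y ^ 2) ↔ HasCycSqrt n x := by
  refine ⟨fun h => ?_, fun h => h.mul (sq n y)⟩
  have := h.mul (sq n y).inv
  rwa [mul_inv_cancel_right₀ (pow_ne_zero 2 hy)] at this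

theorem neg_one (hn : n ≠ 0) (h : 4 ∣ n) : HasCycSqrt n (-1) := by
  refine ⟨Complex.I, ?_, by simp⟩
  obtain ⟨k, rfl⟩ := h
  exact mem_cycField_of_pow_eq_one hn (by rw [pow_mul, Complex.I_pow_four, one_pow])

theorem two (hn : n ≠ 0) (h : 8 ∣ n) : HasCycSqrt n 2 := by
  have h8 := Complex.isPrimitiveRoot_exp 8 (by norm_num)
  set z := Complex.exp (2 * Real.pi * Complex.I / (8 : ℕ))
  have hz4 : z ^ 4 = -1 := by
    have := h8.pow (a := 4) (b := 2) (by norm_num) (by norm_num)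
    exact this.eq_neg_one_of_two_right
  have hz : z ∈ cycField n := by
    obtain ⟨k, rfl⟩ := h
    exact mem_cycField_of_pow_eq_one hn (by rw [pow_mul, h8.pow_eq_one, one_pow])
  -- As `z⁴ = -1`, this is `z + z⁻¹`, a square root of 2.
  refine ⟨z - z ^ 3, sub_mem hz (pow_mem hz 3), ?_⟩
  push_cast
  linear_combination (z ^ 2 - 2) * hz4

/-- The quadratic Gauss sum modulo `p` lies in the field and squares to `χ(-1) * p`, which is 1
modulo 4. -/
theorem odd_prime (hn : n ≠ 0) {p : ℕ} (hp : p.Prime) (hp2 : p ≠ 2) (h : p ∣ n) :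
    ∃ e : ℤ, e ^ 2 = 1 ∧ (e * p) % 4 = 1 ∧ HasCycSqrt n (e * p) := by
  have : Fact p.Prime := ⟨hp⟩
  have hpp := Complex.isPrimitiveRoot_exp p hp.ne_zero
  have hchar : ringChar (ZMod p) ≠ 2 := by rwa [ZMod.ringChar_zmod_n]
  set χ := (quadraticChar (ZMod p)).ringHomComp (Int.castRingHom ℂ) with hχ
  have hinj : Function.Injective (Int.castRingHom ℂ) := (Int.castRingHom ℂ).injective_int
  have hsq := gaussSum_sq (χ := χ) ((MulChar.ringHomComp_ne_one_iff hinj).2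
    (quadraticChar_ne_one hchar)) ((quadraticChar_isQuadratic _).comp _)
    (AddChar.zmodChar_primitive_of_primitive_root p hpp)
  have hmem : gaussSum χ (AddChar.zmodChar p hpp.pow_eq_one) ∈ cycField n := by
    refine sum_mem fun a _ => mul_mem ?_ ?_
    · exact intCast_mem _ _
    · rw [AddChar.zmodChar_apply]
      refine pow_mem ?_ _
      exact cycField_mono hp.ne_zero hn h (IntermediateField.mem_adjoin_simple_self ℚ _)
  have hodd : p % 2 = 1 := hp.eq_two_or_odd.resolve_left hp2
  refine ⟨quadraticChar (ZMod p) (-1), ?_, ?_, _, hmem, ?_⟩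
  · exact quadraticChar_sq_one (by simp)
  · rw [quadraticChar_neg_one hchar, ZMod.card, ZMod.χ₄_nat_eq_if_mod_four]
    split_ifs <;> omega
  · rw [hsq, ZMod.card]
    simp [hχ]

theorem odd_nat (hn : n ≠ 0) (hm : Odd m) (h : m ∣ n) :
    ∃ e : ℤ, e ^ 2 = 1 ∧ (e * m) % 4 = 1 ∧ HasCycSqrt n (e * m) := by
  induction m using induction_on_primes with
  | zero => exact absurd hm (by decide)
  | one => exact ⟨1, by norm_num, by norm_num, by simpa using one n⟩
  | prime_mul p a hp ih =>
    obtain ⟨hp1, ha⟩ := Nat.odd_mul.1 hm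
    obtain ⟨e, he, he4, hs⟩ := ih ha (dvd_of_mul_left_dvd h)
    obtain ⟨f, hf, hf4, ht⟩ := odd_prime hn hp (by rintro rfl; exact absurd hp1 (by decide))
      (dvd_of_mul_right_dvd h)
    refine ⟨f * e, by rw [mul_pow, hf, he, mul_one], ?_, ?_⟩
    · push_cast
      rw [mul_mul_mul_comm, Int.mul_emod, hf4, he4]; norm_num
    · have := ht.mul hs
      push_cast
      rwa [mul_mul_mul_comm]

theorem odd_int_of_emod_four (hn : n ≠ 0) {d : ℤ} (hd4 : d % 4 = 1) (h : d ∣ n) :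
    HasCycSqrt n d := by
  -- The sign `e` is determined by the residue 1 modulo 4, hence is the sign of `d`.
  obtain ⟨e, he, he4, hs⟩ := odd_nat (m := d.natAbs) hn (by
    rw [Int.natAbs_odd, Int.odd_iff]; omega) (Int.natAbs_dvd_natAbs.2 h)
  have : e * d.natAbs = d := by
    have he' : e = 1 ∨ e = -1 := by rwa [← sq_eq_sq_iff_eq_or_eq_neg, one_pow]
    rcases he' with rfl | rfl <;> omega
  have h2 : ((e : ℚ) * d.natAbs) = d := by
    conv_rhs => rw [← this]
    rw [Int.cast_mul, Int.cast_natCast]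
  rwa [h2] at hs

theorem odd_int_of_four_dvd (hn : n ≠ 0) {d : ℤ} (hd : Odd d) (h4 : 4 ∣ n) (h : d ∣ n) :
    HasCycSqrt n d := by
  rw [Int.odd_iff] at hd
  rcases (by omega : d % 4 = 1 ∨ (-d) % 4 = 1) with h1 | h1
  · exact odd_int_of_emod_four hn h1 h
  · have := (neg_one hn h4).mul (odd_int_of_emod_four hn h1 ((neg_dvd).2 h))
    simpa using this

theorem four_dvd_of_neg_one (hn : n ≠ 0) (hn2 : 2 ∣ n) (h : HasCycSqrt n (-1)) : 4 ∣ n := by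
  obtain ⟨z, hz, h1⟩ := h
  have h4 : IsPrimitiveRoot z 4 := by
    refine IsPrimitiveRoot.of_map_of_injective (f := MonoidHom.id ℂ) ?_ Function.injective_id
    have : z ^ (2 ^ 1) = -1 := by rw [pow_one, h1]; simp
    have h3 : orderOf z = 2 ^ 2 := orderOf_eq_prime_pow (p := 2) (n := 1)
      (by rw [this]; norm_num) (by rw [pow_succ 2 1, pow_mul, this]; norm_num)
    have := IsPrimitiveRoot.orderOf z
    rw [h3] at this
    exact this
  have := dvd_of_isPrimitiveRoot_mem_cycField (by norm_num) hn h4 hz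
  rwa [if_pos (even_iff_two_dvd.2 hn2)] at this

theorem eight_dvd_of_two (hn : n ≠ 0) (hn2 : 4 ∣ n) (h : HasCycSqrt n 2) : 8 ∣ n := by
  obtain ⟨z, hz, h1⟩ := h
  obtain ⟨i, hi, h2⟩ := neg_one hn hn2
  push_cast at h1 h2
  -- With `z² = 2` and `i² = -1`, this element squares to `i`, so it is a primitive 8th root of
  -- unity.
  have hw : z * (1 + i) / 2 ∈ cycField n :=
    div_mem (mul_mem hz (add_mem (one_mem _) hi)) (ofNat_mem _ 2)
  have hw2 : (z * (1 + i) / 2) ^ 2 = i := by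
    linear_combination ((1 + i) ^ 2 / 4) * h1 + h2 / 2
  have h4 : IsPrimitiveRoot (z * (1 + i) / 2) 8 := by
    have h5 : (z * (1 + i) / 2) ^ 4 = -1 := by
      rw [show 4 = 2 * 2 from rfl, pow_mul, hw2, h2]
    have h3 : orderOf (z * (1 + i) / 2) = 2 ^ 3 := orderOf_eq_prime_pow (p := 2) (n := 2)
      (by norm_num1; rw [h5]; norm_num) (by norm_num1; rw [show 8 = 4 * 2 from rfl, pow_mul, h5]; norm_num)
    have := IsPrimitiveRoot.orderOf (z * (1 + i) / 2)
    rw [h3] at this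
    exact this
  have := dvd_of_isPrimitiveRoot_mem_cycField (by norm_num) hn h4 hw
  rwa [if_pos (even_iff_two_dvd.2 (dvd_trans (by norm_num) hn2))] at this

end HasCycSqrt

theorem prime_dvd_of_dvd_discr_cycField {n p : ℕ} [NeZero n] (hp : p.Prime)
    (h : (p : ℤ) ∣ NumberField.discr (cycField n)) : p ∣ n := by
  have h1 := Int.natCast_dvd.1 h
  rw [IsCyclotomicExtension.Rat.natAbs_discr n] at h1
  exact hp.dvd_of_dvd_pow (h1.trans (Nat.div_dvd_of_dvd
    (Nat.prod_primeFactors_pow_totient_ediv_dvd (NeZero.pos n))))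

/-- The discriminant of a subfield divides that of the field, and the discriminant of the cyclotomic
field involves only primes dividing `n`. -/
theorem HasCycSqrt.prime_dvd {n p : ℕ} (hn : n ≠ 0) {x : ℚˣ} (h : HasCycSqrt n x) (hp : p.Prime)
    (hpx : (p : ℤ) ∣ quadDisc x) : p ∣ n := by
  have : NeZero n := ⟨hn⟩
  obtain ⟨z, hz, h1⟩ := h
  have hle : sqrtField x ≤ cycField n := by
    rw [sqrtField_eq_adjoin h1, IntermediateField.adjoin_simple_le_iff]
    exact hz
  let _ : Algebra (sqrtField x) (cycField n) := (IntermediateField.inclusion hle).toRingHom.toAlgebra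
  exact prime_dvd_of_dvd_discr_cycField hp
    (hpx.trans (NumberField.discr_dvd_discr (sqrtField x) (cycField n)))

theorem dvd_natCast_of_forall_prime_dvd {d : ℤ} (hd : Squarefree d) {n : ℕ}
    (h : ∀ p : ℕ, p.Prime → (p : ℤ) ∣ d → p ∣ n) : d ∣ n := by
  rw [← Int.natAbs_dvd, Int.natCast_dvd_natCast,
    ← Nat.prod_primeFactors_of_squarefree (Int.squarefree_natAbs.2 hd)]
  refine Finset.prod_primes_dvd n (fun p hp => (Nat.prime_of_mem_primeFactors hp).prime) ?_
  exact fun p hp => h p (Nat.prime_of_mem_primeFactors hp)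
    (Int.natCast_dvd.2 (Nat.dvd_of_mem_primeFactors hp))

/-- A square root of a rational `x` lies in the `n`-th cyclotomic field if and only if
the discriminant of `ℚ(√x)` divides `n`. -/
theorem hasCycSqrt_iff_quadDisc_dvd {n : ℕ} (hn : n ≠ 0) (x : ℚˣ) :
    HasCycSqrt n x ↔ quadDisc x ∣ n := by
  obtain ⟨d, q, hd, hq, hx, hdisc⟩ := exists_quadDisc_eq x
  have hprime : HasCycSqrt n x → d ∣ n := fun h => dvd_natCast_of_forall_prime_dvd hd
    fun p hp hpd => h.prime_dvd hn hp (by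
      rcases hdisc with ⟨-, h⟩ | ⟨-, h⟩ <;> rw [h]
      · exact hpd
      · exact hpd.mul_left 4)
  have htwo : d % 4 ≠ 1 → HasCycSqrt n x → 2 ∣ n := fun hd4 h => h.prime_dvd hn Nat.prime_two (by
      rcases hdisc with ⟨h, -⟩ | ⟨-, h⟩
      · exact absurd h hd4
      · rw [h]; exact Dvd.dvd.mul_right (by norm_num) d)
  rw [hx, HasCycSqrt.mul_sq_iff hq] at hprime htwo
  rw [hx, HasCycSqrt.mul_sq_iff hq]
  have hd4 : d % 4 ≠ 0 := fun h4 => by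
    have := hd 2 (by norm_num; omega)
    exact absurd (Int.isUnit_iff.1 this) (by norm_num)
  rcases hdisc with ⟨h4, hdisc⟩ | ⟨h4, hdisc⟩ <;> rw [hdisc]
  · exact ⟨hprime, HasCycSqrt.odd_int_of_emod_four hn h4⟩
  rcases Int.even_or_odd d with heven | hodd
  · obtain ⟨m, rfl⟩ := heven.two_dvd
    have hmodd : Odd m := by rw [Int.odd_iff]; omega
    constructor
    · intro h
      have h2n := htwo h4 h
      -- At a level divisible by 4 the odd part `√m` is available, so `√2` can be split off from
      -- `√(2m)`. The resulting `8 ∣ N` descends to `n`: if `4 ∤ n`, then `N` divides `4 * (n / 2)`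
      -- with `n / 2` odd.
      set N := Nat.lcm n 4 with hN
      have hN0 : N ≠ 0 := Nat.lcm_ne_zero hn (by norm_num)
      have hmn : m ∣ n := (Dvd.intro_left 2 rfl).trans (hprime h)
      have hnN : n ∣ N := Nat.dvd_lcm_left n 4
      have hs := h.mono hn hN0 hnN
      have hm := HasCycSqrt.odd_int_of_four_dvd hN0 hmodd (Nat.dvd_lcm_right n 4)
        (hmn.trans (by exact_mod_cast hnN))
      have h2 := hs.mul hm
      have hm0 : (m : ℚ) ≠ 0 := by
        have : m ≠ 0 := by rintro rfl; simp at hmodd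
        exact_mod_cast this
      rw [show ((2 * m : ℤ) : ℚ) * m = 2 * (m : ℚ) ^ 2 by push_cast; ring,
        HasCycSqrt.mul_sq_iff hm0] at h2
      have h8 := h2.eight_dvd_of_two hN0 (Nat.dvd_lcm_right n 4)
      have h8n : 8 ∣ n := by
        by_cases h4n : 4 ∣ n
        · rwa [hN, Nat.lcm_eq_left h4n] at h8
        · have hdvd : N ∣ 4 * (n / 2) := Nat.lcm_dvd ⟨2, by omega⟩ (dvd_mul_right _ _)
          have := h8.trans hdvd
          omega
      have h8' : (8 : ℤ) ∣ n := by exact_mod_cast h8n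
      rw [← mul_assoc]
      refine IsCoprime.mul_dvd ?_ h8' hmn
      rw [show (4 * 2 : ℤ) = 2 ^ 3 by norm_num]
      exact (Int.isCoprime_two_left.2 hmodd).pow_left
    · intro h
      have h8 : (8 : ℤ) ∣ n := by
        refine Dvd.dvd.trans ?_ h
        rw [← mul_assoc]; exact dvd_mul_right _ _
      have h8 : 8 ∣ n := by exact_mod_cast h8
      have hm := HasCycSqrt.odd_int_of_four_dvd hn hmodd (dvd_trans (by norm_num) h8)
        (Dvd.dvd.trans ⟨8, by ring⟩ h)
      have := (HasCycSqrt.two hn h8).mul hm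
      push_cast
      exact this
  · constructor
    · intro h
      have h2n := htwo h4 h
      have hdn := hprime h
      -- Here `d` is 3 modulo 4, so `√(-d)` is available and `√d * √(-d)` yields `√-1`.
      have hneg := HasCycSqrt.odd_int_of_emod_four (d := -d) hn (by rw [Int.odd_iff] at hodd; omega)
        (neg_dvd.2 hdn)
      have h1 := h.mul hneg
      have hd0 : (d : ℚ) ≠ 0 := by exact_mod_cast hd.ne_zero
      rw [show (d : ℚ) * (-d : ℤ) = -1 * (d : ℚ) ^ 2 by push_cast; ring,
        HasCycSqrt.mul_sq_iff hd0] at h1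
      have h4n := h1.four_dvd_of_neg_one hn h2n
      have h4n' : (4 : ℤ) ∣ n := by exact_mod_cast h4n
      refine IsCoprime.mul_dvd ?_ h4n' hdn
      rw [show (4 : ℤ) = 2 ^ 2 by norm_num]
      exact (Int.isCoprime_two_left.2 hodd).pow_left
    · intro h
      have h4n : (4 : ℤ) ∣ n := (dvd_mul_right _ _).trans h
      exact HasCycSqrt.odd_int_of_four_dvd hn hodd (by exact_mod_cast h4n)
        ((dvd_mul_left _ _).trans h)

end RadicalDegree

/-! ### Kummer theory: counting monomials in two radicals -/

section Kummer

variable {F M : Type*} [Field F] [Field M] [Algebra F M]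

/-- The minimal polynomial of a generator divides some `X ^ m - r`, which splits as soon as one root
is adjoined because `F` has the `m`-th roots of unity. -/
theorem isGalois_adjoin_of_pow_eq_algebraMap [CharZero F] {S : Set M}
    (h : ∀ z ∈ S, ∃ m ≠ 0, ∃ ζ r : F, IsPrimitiveRoot ζ m ∧ z ^ m = algebraMap F M r) :
    IsGalois F (IntermediateField.adjoin F S) := by
  have hint : ∀ z ∈ S, IsIntegral F z := fun z hz => by
    obtain ⟨m, hm, -, r, -, hr⟩ := h z hz
    exact IsIntegral.of_pow (Nat.pos_of_ne_zero hm) (hr ▸ isIntegral_algebraMap)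
  have hint' : ∀ z : IntermediateField.adjoin F S, IsIntegral F z := by
    have : Algebra.IsAlgebraic F (IntermediateField.adjoin F S) :=
      IntermediateField.isAlgebraic_adjoin hint
    exact fun z => Algebra.IsIntegral.isIntegral z
  have hnormal : Normal F (IntermediateField.adjoin F S) := by
    refine normal_iff.2 fun z => ⟨hint' z, ?_⟩
    have hz : minpoly F z = minpoly F (z : M) := by
      rw [← minpoly.algebraMap_eq (algebraMap (IntermediateField.adjoin F S) M).injective z]
      rfl
    rw [hz]
    refine IntermediateField.splits_of_mem_adjoin F M (fun y hy => ⟨hint y hy, ?_⟩) z.2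
    obtain ⟨m, hm, ζ, r, hζ, hr⟩ := h y hy
    have hsplit : (X ^ m - C (algebraMap F (IntermediateField.adjoin F S) r)).Splits :=
      X_pow_sub_C_splits_of_isPrimitiveRoot (hζ.map_of_injective
        (algebraMap F (IntermediateField.adjoin F S)).injective)
        (α := ⟨y, IntermediateField.subset_adjoin F S hy⟩) (Subtype.ext hr)
    refine hsplit.of_dvd (X_pow_sub_C_ne_zero (Nat.pos_of_ne_zero hm) _) ?_
    have : minpoly F y ∣ X ^ m - C r := minpoly.dvd F y (by simp [hr])
    simpa using Polynomial.map_dvd (algebraMap F (IntermediateField.adjoin F S)) this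
  exact { }

/-- As its values lie in `F`, the map `g ↦ g c / c` is a character of the Galois group, trivial
exactly when `c ∈ F`. This is orthogonality: multiplying by a nontrivial value permutes the sum. -/
theorem sum_galois_apply_div {E : Type*} [Field E] [Algebra F E] [FiniteDimensional F E]
    [IsGalois F E] [Fintype Gal(E/F)] {c : E} (hc : c ≠ 0)
    (h : ∀ g : Gal(E/F), ∃ ξ : F, g c / c = algebraMap F E ξ)
    [Decidable (c ∈ Set.range (algebraMap F E))] :
    ∑ g : Gal(E/F), g c / c =
      if c ∈ Set.range (algebraMap F E) then (Fintype.card Gal(E/F) : E) else 0 := by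
  split_ifs with hcF
  · obtain ⟨r, rfl⟩ := hcF
    simp [div_self hc]
  · obtain ⟨k, hk⟩ : ∃ k : Gal(E/F), k c ≠ c := by
      by_contra! hall
      exact hcF (IntermediateField.mem_bot.1 ((IsGalois.mem_bot_iff_fixed c).2 hall))
    have hmul : ∀ g : Gal(E/F), (g * k) c / c = (k c / c) * (g c / c) := fun g => by
      obtain ⟨ξ, hξ⟩ := h k
      have hk : k c = algebraMap F E ξ * c := by rw [← hξ, div_mul_cancel₀ _ hc]
      rw [hξ, AlgEquiv.mul_apply, hk, map_mul, AlgEquiv.commutes, mul_div_assoc]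
    have hsum : ∑ g : Gal(E/F), g c / c = (k c / c) * ∑ g : Gal(E/F), g c / c := by
      rw [Finset.mul_sum]
      simp_rw [← hmul]
      exact (Equiv.sum_comp (Equiv.mulRight k) fun g : Gal(E/F) => g c / c).symm
    have h1 : (k c / c - 1) * ∑ g : Gal(E/F), g c / c = 0 := by
      rw [sub_mul, one_mul, ← hsum, sub_self]
    refine (mul_eq_zero.1 h1).resolve_left fun h2 => hk ?_
    rwa [sub_eq_zero, div_eq_one_iff_eq hc] at h2

theorem sum_range_pow_of_pow_eq_one {E : Type*} [Field E] {m : ℕ} {ξ : E} (hξ : ξ ^ m = 1)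
    [Decidable (ξ = 1)] :
    ∑ x ∈ Finset.range m, ξ ^ x = if ξ = 1 then (m : E) else 0 := by
  split_ifs with h
  · simp [h]
  · have := mul_neg_geom_sum ξ m
    rw [hξ, sub_self] at this
    exact (mul_eq_zero.1 this).resolve_left (sub_ne_zero.2 (Ne.symm h))

open Classical in
/-- For a Kummer extension `E = F(α, β)` with `αⁿ, βⁱ ∈ F`, the degree of `E` over `F` times the
number of monomials in `α, β` (with exponents modulo `n, i`) lying in `F` is `n * i`. -/
theorem card_filter_mem_mul_finrank_adjoin_pair [CharZero F] {n i : ℕ} (hn : n ≠ 0) (hi : i ≠ 0)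
    {ζ η r t : F} (hζ : IsPrimitiveRoot ζ n) (hη : IsPrimitiveRoot η i) {α β : M} (hα0 : α ≠ 0)
    (hβ0 : β ≠ 0) (hα : α ^ n = algebraMap F M r) (hβ : β ^ i = algebraMap F M t) :
    ((Finset.range n ×ˢ Finset.range i).filter
      fun p => α ^ p.1 * β ^ p.2 ∈ Set.range (algebraMap F M)).card *
      Module.finrank F (IntermediateField.adjoin F {α, β}) = n * i := by
  have hroot : ∀ z ∈ ({α, β} : Set M),
      ∃ m ≠ 0, ∃ ζ r : F, IsPrimitiveRoot ζ m ∧ z ^ m = algebraMap F M r := by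
    rintro z (rfl | rfl)
    · exact ⟨n, hn, ζ, r, hζ, hα⟩
    · exact ⟨i, hi, η, t, hη, hβ⟩
  have : IsGalois F (IntermediateField.adjoin F {α, β}) :=
    isGalois_adjoin_of_pow_eq_algebraMap hroot
  have : FiniteDimensional F (IntermediateField.adjoin F {α, β}) :=
    IntermediateField.finiteDimensional_adjoin fun z hz => by
      obtain ⟨m, hm, -, r, -, hr⟩ := hroot z hz
      exact IsIntegral.of_pow (Nat.pos_of_ne_zero hm) (hr ▸ isIntegral_algebraMap)
  set E := IntermediateField.adjoin F {α, β} with hE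
  have : CharZero E := charZero_of_injective_algebraMap (algebraMap F E).injective
  let _ : Fintype Gal(E/F) := Fintype.ofFinite _
  set a : E := ⟨α, IntermediateField.subset_adjoin F _ (by simp)⟩
  set b : E := ⟨β, IntermediateField.subset_adjoin F _ (by simp)⟩
  have ha0 : a ≠ 0 := fun h => hα0 (congrArg Subtype.val h)
  have hb0 : b ≠ 0 := fun h => hβ0 (congrArg Subtype.val h)
  have ha : a ^ n = algebraMap F E r := Subtype.ext hα
  have hb : b ^ i = algebraMap F E t := Subtype.ext hβ
  have quot : ∀ {m : ℕ} {c : E} {r : F}, c ≠ 0 → c ^ m = algebraMap F E r →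
      ∀ g : Gal(E/F), (g c / c) ^ m = 1 := fun hc h g => by
    rw [div_pow, ← map_pow, h, AlgEquiv.commutes, div_self]
    rw [← h]
    exact pow_ne_zero _ hc
  have hqF : ∀ {m : ℕ} {c : E} {r ζ : F}, m ≠ 0 → IsPrimitiveRoot ζ m → c ≠ 0 →
      c ^ m = algebraMap F E r → ∀ g : Gal(E/F), ∃ ξ : F, g c / c = algebraMap F E ξ :=
    fun {m c r ζ} hm hζ hc h g => by
      have : NeZero m := ⟨hm⟩
      obtain ⟨k, -, hk⟩ := (hζ.map_of_injective (algebraMap F E).injective).eq_pow_of_pow_eq_one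
        (quot hc h g)
      exact ⟨ζ ^ k, by rw [map_pow, hk]⟩
  have hmon : ∀ (g : Gal(E/F)) (x y : ℕ),
      g (a ^ x * b ^ y) / (a ^ x * b ^ y) = (g a / a) ^ x * (g b / b) ^ y := fun g x y => by
    rw [map_mul, map_pow, map_pow, div_pow, div_pow, mul_div_mul_comm]
  have hrange : ∀ x y : ℕ, α ^ x * β ^ y ∈ Set.range (algebraMap F M) ↔
      a ^ x * b ^ y ∈ Set.range (algebraMap F E) := fun x y => by
    constructor
    · rintro ⟨s, hs⟩
      exact ⟨s, Subtype.ext hs⟩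
    · rintro ⟨s, hs⟩
      exact ⟨s, congrArg Subtype.val hs⟩
  -- The count comes from summing `g c / c` over all `g` and all monomials `c` in both orders. For
  -- fixed `g` the sum is a product of two geometric sums, nonzero only if `g` fixes both
  -- generators; for fixed `c`, orthogonality applies.
  have h1 : ∀ g : Gal(E/F), ∑ p ∈ Finset.range n ×ˢ Finset.range i,
      g (a ^ p.1 * b ^ p.2) / (a ^ p.1 * b ^ p.2) = if g = 1 then (n * i : E) else 0 := fun g => by
    simp_rw [hmon]
    rw [Finset.sum_product]
    simp_rw [← Finset.mul_sum, ← Finset.sum_mul]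
    rw [sum_range_pow_of_pow_eq_one (quot ha0 ha g), sum_range_pow_of_pow_eq_one (quot hb0 hb g),
      ite_zero_mul_ite_zero]
    have : (g a / a = 1 ∧ g b / b = 1) ↔ g = 1 := by
      rw [div_eq_one_iff_eq ha0, div_eq_one_iff_eq hb0]
      refine ⟨fun h => ?_, fun h => by simp [h]⟩
      apply AlgEquiv.coe_toAlgHom_injective
      refine IntermediateField.algHom_ext_of_eq_adjoin F hE ?_
      rintro z (rfl | rfl)
      · exact h.1
      · exact h.2
    simp only [this]
  have h2 : ∀ p : ℕ × ℕ, ∑ g : Gal(E/F), g (a ^ p.1 * b ^ p.2) / (a ^ p.1 * b ^ p.2) =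
      if α ^ p.1 * β ^ p.2 ∈ Set.range (algebraMap F M) then (Fintype.card Gal(E/F) : E) else 0 :=
    fun p => by
      simp only [hrange]
      refine sum_galois_apply_div (mul_ne_zero (pow_ne_zero _ ha0) (pow_ne_zero _ hb0)) fun g => ?_
      obtain ⟨ξ, hξ⟩ := hqF hn hζ ha0 ha g
      obtain ⟨θ, hθ⟩ := hqF hi hη hb0 hb g
      exact ⟨ξ ^ p.1 * θ ^ p.2, by rw [hmon, hξ, hθ]; simp⟩
  have key := Finset.sum_comm (s := Finset.range n ×ˢ Finset.range i)
    (t := (Finset.univ : Finset Gal(E/F)))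
    (f := fun p g => g (a ^ p.1 * b ^ p.2) / (a ^ p.1 * b ^ p.2))
  simp_rw [h1, h2] at key
  rw [Finset.sum_ite_eq' Finset.univ (1 : Gal(E/F)), if_pos (Finset.mem_univ _), ← Finset.sum_filter,
    Finset.sum_const, nsmul_eq_mul] at key
  rw [← IsGalois.card_aut_eq_finrank, Nat.card_eq_fintype_card]
  exact_mod_cast key

end Kummer

/-! ### Rationality of squared absolute values -/

namespace RadicalDegree

/-- If some power of an element of a cyclotomic field is rational, then so is its squared
absolute value. -/
theorem exists_normSq_eq_ratCast {n m : ℕ} (hn : n ≠ 0) (hm : m ≠ 0) {c : ℂ} (hc : c ∈ cycField n)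
    {r : ℚ} (hr : c ^ m = r) : ∃ ρ : ℚ, Complex.normSq c = ρ := by
  have : NeZero n := ⟨hn⟩
  have hζ := Complex.isPrimitiveRoot_exp n hn
  set ζ := Complex.exp (2 * Real.pi * Complex.I / n) with hζdef
  have hgalois : IsGalois ℚ (cycField n) := IsCyclotomicExtension.isGalois {n} ℚ _
  have hconj : ∀ {ξ : ℂ}, ξ ^ n = 1 → starRingEnd ℂ ξ = ξ ^ (n - 1) := fun {ξ} hξ => by
    have h0 : ξ ≠ 0 := by rintro rfl; simp [hn] at hξ
    have h1 : ‖ξ‖ = 1 := Complex.norm_eq_one_of_pow_eq_one hξ hn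
    rw [← Complex.inv_eq_conj h1]
    refine inv_eq_of_mul_eq_one_right ?_
    rw [← pow_succ', Nat.sub_add_cancel (Nat.pos_of_ne_zero hn), hξ]
  -- Conjugation acts on `n`-th roots of unity as the power `n - 1`, so `|p(ξ)|²` is a rational
  -- polynomial in `ξ`, the same one for every Galois conjugate of `ξ`.
  have hnorm : ∀ {ξ : ℂ} (p : ℚ[X]), ξ ^ n = 1 →
      aeval ξ (p * p.comp (X ^ (n - 1))) = (Complex.normSq (aeval ξ p) : ℂ) := fun {ξ} p hξ => by
    rw [map_mul, aeval_comp, Complex.normSq_eq_conj_mul_self, mul_comm]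
    congr 1
    rw [map_pow, aeval_X, ← hconj hξ]
    exact aeval_algHom_apply (Complex.conjAe.toAlgHom.restrictScalars ℚ) ξ p
  obtain ⟨p, rfl⟩ : ∃ p : ℚ[X], aeval ζ p = c := by
    have hint : IsAlgebraic ℚ ζ := (hζ.isIntegral (Nat.pos_of_ne_zero hn)).tower_top.isAlgebraic
    have : c ∈ (IntermediateField.adjoin ℚ {ζ}).toSubalgebra := hc
    rw [IntermediateField.adjoin_simple_toSubalgebra_of_isAlgebraic hint,
      Algebra.adjoin_singleton_eq_range_aeval] at this
    exact this
  set z : cycField n := ⟨ζ, IntermediateField.mem_adjoin_simple_self ℚ _⟩ with hz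
  set q := p * p.comp (X ^ (n - 1)) with hq
  have hcoe : ∀ (w : cycField n) (f : ℚ[X]), ((aeval w f : cycField n) : ℂ) = aeval (w : ℂ) f :=
    fun w f => (aeval_algebraMap_apply ℂ w f).symm
  have hzn : z ^ n = 1 := Subtype.ext hζ.pow_eq_one
  have hzr : aeval z p ^ m = algebraMap ℚ _ r := Subtype.ext (by
    push_cast
    rw [hcoe]
    exact hr)
  have hpow : ∀ g : Gal(cycField n/ℚ),
      Complex.normSq (aeval ((g z : cycField n) : ℂ) p) ^ m = (r : ℝ) ^ 2 := fun g => by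
    have h1 : aeval (g z) p ^ m = algebraMap ℚ (cycField n) r := by
      rw [← AlgEquiv.coe_toAlgHom, aeval_algHom_apply, ← map_pow, hzr]
      exact g.commutes r
    have h2 : (aeval ((g z : cycField n) : ℂ) p) ^ m = r := by
      have := congrArg Subtype.val h1
      push_cast at this
      rw [hcoe] at this
      exact this
    rw [← map_pow, h2, ← Complex.ofReal_ratCast, Complex.normSq_ofReal, sq]
  -- The conjugates of `|c|²` are nonnegative reals with the same `m`-th power `r²`, hence are all
  -- equal.
  have hfix : aeval z q ∈ (⊥ : IntermediateField ℚ (cycField n)) := by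
    rw [IsGalois.mem_bot_iff_fixed]
    intro g
    apply Subtype.ext
    have h1 : g (aeval z q) = aeval (g z) q := by
      rw [← AlgEquiv.coe_toAlgHom, aeval_algHom_apply]
    have hgz : ((g z : cycField n) : ℂ) ^ n = 1 := by
      have : (g z) ^ n = 1 := by rw [← map_pow, hzn, map_one]
      exact congrArg Subtype.val this
    rw [h1, hcoe, hcoe, hnorm p hgz, hnorm p hζ.pow_eq_one, Complex.ofReal_inj]
    refine (pow_left_inj₀ (Complex.normSq_nonneg _) (Complex.normSq_nonneg _) hm).1 ?_
    rw [hpow g]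
    exact (hpow 1).symm
  obtain ⟨ρ, hρ⟩ := IntermediateField.mem_bot.1 hfix
  refine ⟨ρ, ?_⟩
  have h1 := congrArg Subtype.val hρ
  rw [hcoe, hnorm p hζ.pow_eq_one] at h1
  have h2 : ((ρ : ℝ) : ℂ) = (Complex.normSq (aeval ζ p) : ℂ) := by
    rw [Complex.ofReal_ratCast]; exact h1
  exact (Complex.ofReal_inj.1 h2).symm

/-! ### The factor group and finiteness of its torsion -/

theorem mem_closure_neg_one_pair {a b r : ℚˣ} :
    r ∈ Subgroup.closure ({-1, a, b} : Set ℚˣ) ↔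
      ∃ x y : ℤ, r = a ^ x * b ^ y ∨ r = -(a ^ x * b ^ y) := by
  have hn : (-1 : ℚˣ) ∈ Subgroup.closure ({-1, a, b} : Set ℚˣ) := Subgroup.subset_closure (by simp)
  have ha : a ∈ Subgroup.closure ({-1, a, b} : Set ℚˣ) := Subgroup.subset_closure (by simp)
  have hb : b ∈ Subgroup.closure ({-1, a, b} : Set ℚˣ) := Subgroup.subset_closure (by simp)
  constructor
  · intro h
    induction h using Subgroup.closure_induction with
    | mem z hz =>
      rcases hz with rfl | rfl | rfl
      · exact ⟨0, 0, by simp⟩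
      · exact ⟨1, 0, by simp⟩
      · exact ⟨0, 1, by simp⟩
    | one => exact ⟨0, 0, by simp⟩
    | mul z w _ _ hz hw =>
      obtain ⟨x, y, h1⟩ := hz
      obtain ⟨u, v, h2⟩ := hw
      refine ⟨x + u, y + v, ?_⟩
      have : a ^ (x + u) * b ^ (y + v) = (a ^ x * b ^ y) * (a ^ u * b ^ v) := by
        rw [zpow_add, zpow_add, mul_mul_mul_comm]
      rw [this]
      rcases h1 with rfl | rfl <;> rcases h2 with rfl | rfl <;> simp
    | inv z _ hz =>
      obtain ⟨x, y, h1⟩ := hz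
      refine ⟨-x, -y, ?_⟩
      rcases h1 with rfl | rfl <;> simp [mul_comm]
  · rintro ⟨x, y, rfl | rfl⟩
    · exact mul_mem (zpow_mem ha x) (zpow_mem hb y)
    · rw [← neg_one_mul (a ^ x * b ^ y)]
      exact mul_mem hn (mul_mem (zpow_mem ha x) (zpow_mem hb y))

theorem mk_mem_torsionSubgroup {a b r : ℚˣ} :
    (QuotientGroup.mk r : FactorGroup a b) ∈ torsionSubgroup a b ↔
      ∃ m : ℕ, 0 < m ∧ r ^ m ∈ Subgroup.closure ({-1, a, b} : Set ℚˣ) := by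
  rw [CommGroup.mem_torsion, isOfFinOrder_iff_pow_eq_one]
  simp_rw [← QuotientGroup.mk_pow, QuotientGroup.eq_one_iff]

theorem mem_closure_of_padicValRat_eq_zero (S : Set ℕ) {r : ℚˣ}
    (hr : ∀ p : ℕ, p.Prime → p ∉ S → padicValRat p r = 0) :
    r ∈ Subgroup.closure ({u : ℚˣ | u = -1 ∨ ∃ p ∈ S, (u : ℚ) = p}) := by
  set U := Subgroup.closure ({u : ℚˣ | u = -1 ∨ ∃ p ∈ S, (u : ℚ) = p})
  have hnat : ∀ m : ℕ, (∀ p : ℕ, p.Prime → p ∣ m → p ∈ S) → ∀ u : ℚˣ, (u : ℚ) = m → u ∈ U := by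
    intro m
    induction m using induction_on_primes with
    | zero => intro _ u hu; exact absurd hu (by simp)
    | one =>
      intro _ u hu
      rw [show u = 1 from Units.ext (by simpa using hu)]
      exact one_mem U
    | prime_mul p k hp ih =>
      intro hS u hu
      have hp0 : (p : ℚ) ≠ 0 := by exact_mod_cast hp.ne_zero
      have h1 : u * (Units.mk0 (p : ℚ) hp0)⁻¹ ∈ U := ih
        (fun q hq hqk => hS q hq (hqk.mul_left p)) _ (by
          rw [Units.val_mul, hu, Units.val_inv_eq_inv_val, Units.val_mk0]
          push_cast
          field_simp)
      have h2 : Units.mk0 (p : ℚ) hp0 ∈ U :=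
        Subgroup.subset_closure (Or.inr ⟨p, hS p hp (dvd_mul_right p k), rfl⟩)
      simpa using mul_mem h1 h2
  have hr0 : (r : ℚ) ≠ 0 := r.ne_zero
  have hnum0 : (r : ℚ).num ≠ 0 := Rat.num_ne_zero.2 hr0
  have hval : ∀ p : ℕ, p.Prime → (p : ℤ) ∣ (r : ℚ).num * (r : ℚ).den → p ∈ S := by
    intro p hp hdvd
    have : Fact p.Prime := ⟨hp⟩
    by_contra hpS
    have h0 := hr p hp hpS
    rw [padicValRat_def] at h0
    have hcop : ¬ (p ∣ (r : ℚ).num.natAbs ∧ p ∣ (r : ℚ).den) := fun h =>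
      hp.one_lt.ne' (Nat.dvd_one.1 ((r : ℚ).reduced ▸ Nat.dvd_gcd h.1 h.2))
    rcases (Nat.prime_iff_prime_int.1 hp).dvd_or_dvd hdvd with h | h
    · have h1 : p ∣ (r : ℚ).num.natAbs := Int.natCast_dvd.1 h
      have h2 : padicValNat p (r : ℚ).den = 0 := padicValNat.eq_zero_of_not_dvd fun h => hcop ⟨h1, h⟩
      have h3 : 1 ≤ padicValNat p (r : ℚ).num.natAbs :=
        one_le_padicValNat_of_dvd (Int.natAbs_ne_zero.2 hnum0) h1
      rw [padicValInt] at h0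
      omega
    · have h1 : p ∣ (r : ℚ).den := by exact_mod_cast h
      have h2 : padicValNat p (r : ℚ).num.natAbs = 0 :=
        padicValNat.eq_zero_of_not_dvd fun h => hcop ⟨h, h1⟩
      have h3 : 1 ≤ padicValNat p (r : ℚ).den := one_le_padicValNat_of_dvd (r : ℚ).den_ne_zero h1
      rw [padicValInt] at h0
      omega
  have hden0 : ((r : ℚ).den : ℚ) ≠ 0 := by exact_mod_cast (r : ℚ).den_ne_zero
  have hden : Units.mk0 _ hden0 ∈ U := hnat _ (fun p hp h => hval p hp
    (Dvd.dvd.mul_left (by exact_mod_cast h) _)) _ rfl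
  have hnumU : r * Units.mk0 _ hden0 ∈ U := by
    have hrd : ((r * Units.mk0 _ hden0 : ℚˣ) : ℚ) = (r : ℚ).num := Rat.mul_den_eq_num _
    have hnumS : ∀ p : ℕ, p.Prime → p ∣ (r : ℚ).num.natAbs → p ∈ S := fun p hp h =>
      hval p hp ((Int.natCast_dvd.2 h).mul_right _)
    rcases Int.natAbs_eq (r : ℚ).num with h | h
    · refine hnat _ hnumS _ ?_
      rw [hrd]
      rw [← Int.cast_natCast, ← h]
    · have : -(r * Units.mk0 _ hden0) ∈ U := by
        refine hnat _ hnumS _ ?_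
        rw [Units.val_neg, hrd]
        rw [← Int.cast_natCast, ← Int.cast_neg, Int.cast_inj]
        omega
      have hneg : (-1 : ℚˣ) ∈ U := Subgroup.subset_closure (Or.inl rfl)
      simpa using mul_mem hneg this
  simpa using mul_mem hnumU (inv_mem hden)

/-- Subgroups of a finitely generated abelian group are finitely generated, `ℤ` being Noetherian,
and a finitely generated abelian torsion group is finite. -/
theorem finite_torsion_of_le_fg {G : Type*} [CommGroup G] (U : Subgroup G) (hU : U.FG)
    (h : CommGroup.torsion G ≤ U) : Finite (CommGroup.torsion G) := by
  have : Group.FG U := (Group.fg_iff_subgroup_fg U).2 hU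
  have : Module.Finite ℤ (Additive U) := Module.Finite.iff_addGroup_fg.2 inferInstance
  have hT : (CommGroup.torsion U).toAddSubgroup.FG := by
    have := (isNoetherian_def.1 (inferInstance : IsNoetherian ℤ (Additive U)))
      (AddSubgroup.toIntSubmodule (CommGroup.torsion U).toAddSubgroup)
    rw [Submodule.fg_iff_addSubgroup_fg] at this
    simpa using this
  have : Group.FG (CommGroup.torsion U) :=
    (Group.fg_iff_subgroup_fg _).2 ((Subgroup.fg_iff_add_fg _).2 hT)
  have hfin : Finite (CommGroup.torsion U) := CommGroup.finite_of_fg_isMulTorsion _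
    fun g => Submonoid.isOfFinOrder_coe.1 ((CommGroup.mem_torsion _).1 g.2)
  refine Finite.of_injective (β := CommGroup.torsion U)
    (fun g => ⟨⟨g.1, h g.2⟩, (CommGroup.mem_torsion _).2
      (Submonoid.isOfFinOrder_coe.1 ((CommGroup.mem_torsion _).1 g.2))⟩) fun g k hgk => ?_
  simp only [Subtype.mk.injEq] at hgk
  exact Subtype.ext hgk

/-- If a power of `r` lies in `⟨-1, a, b⟩`, then `r` has valuation 0 at every prime where `a` and
`b` do. So the torsion lies in the image of the group generated by `-1` and finitely many primes. -/
theorem finite_torsionSubgroup (a b : ℚˣ) : Finite (torsionSubgroup a b) := by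
  set S : Set ℕ := {p | p.Prime ∧ (padicValRat p a ≠ 0 ∨ padicValRat p b ≠ 0)} with hS
  have hSfin : S.Finite := by
    refine Set.Finite.subset (((a : ℚ).num.natAbs * (a : ℚ).den *
      ((b : ℚ).num.natAbs * (b : ℚ).den)).primeFactors.finite_toSet) ?_
    have key : ∀ (r : ℚˣ) (p : ℕ), padicValRat p r ≠ 0 →
        p ∣ (r : ℚ).num.natAbs * (r : ℚ).den := fun r p h => by
      by_contra hd
      apply h
      rw [padicValRat_def, padicValInt, padicValNat.eq_zero_of_not_dvd fun h => hd (h.mul_right _),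
        padicValNat.eq_zero_of_not_dvd fun h => hd (h.mul_left _)]
      simp
    rintro p ⟨hp, h⟩
    rw [Finset.mem_coe, Nat.mem_primeFactors]
    refine ⟨hp, ?_, by simp⟩
    rcases h with h | h
    · exact (key a p h).mul_right _
    · exact (key b p h).mul_left _
  have hPfin : ({u : ℚˣ | u = -1 ∨ ∃ p ∈ S, (u : ℚ) = p}).Finite := by
    refine (Set.finite_singleton (-1 : ℚˣ)).union (s := {u | u = -1})
      (Set.Finite.of_finite_image (f := fun u : ℚˣ => (u : ℚ))
        ((hSfin.image (fun p : ℕ => (p : ℚ))).subset ?_) Units.val_injective.injOn)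
    rintro _ ⟨u, ⟨p, hp, hu⟩, rfl⟩
    exact ⟨p, hp, hu.symm⟩
  refine finite_torsion_of_le_fg ((Subgroup.closure
    ({u : ℚˣ | u = -1 ∨ ∃ p ∈ S, (u : ℚ) = p})).map (QuotientGroup.mk' _)) ?_ ?_
  · rw [MonoidHom.map_closure]
    exact (Subgroup.fg_iff _).2 ⟨_, rfl, hPfin.image _⟩
  · intro g
    induction g using QuotientGroup.induction_on with
    | H r =>
    intro hg
    obtain ⟨m, hm, hr⟩ := mk_mem_torsionSubgroup.1 hg
    refine ⟨r, mem_closure_of_padicValRat_eq_zero S fun p hp hpS => ?_, rfl⟩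
    have : Fact p.Prime := ⟨hp⟩
    have hpa : padicValRat p a = 0 := by by_contra h; exact hpS ⟨hp, Or.inl h⟩
    have hpb : padicValRat p b = 0 := by by_contra h; exact hpS ⟨hp, Or.inr h⟩
    obtain ⟨x, y, h⟩ := mem_closure_neg_one_pair.1 hr
    have h1 : padicValRat p ((a ^ x * b ^ y : ℚˣ) : ℚ) = 0 := by
      push_cast
      rw [padicValRat.mul (zpow_ne_zero _ a.ne_zero) (zpow_ne_zero _ b.ne_zero),
        padicValRat.zpow, padicValRat.zpow, hpa, hpb]
      simp
    have h2 : padicValRat p ((r ^ m : ℚˣ) : ℚ) = 0 := by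
      rcases h with h | h <;> rw [h]
      · exact h1
      · rw [Units.val_neg, padicValRat.neg, h1]
    rw [Units.val_pow_eq_pow_val, padicValRat.pow] at h2
    have hm0 : (m : ℤ) ≠ 0 := by exact_mod_cast hm.ne'
    exact (mul_eq_zero.1 h2).resolve_left hm0

/-! ### The degree as a count of monomials -/

open Classical in
/-- The exponents `(x, y)` with `0 ≤ x < n` and `0 ≤ y < i` such that `αˣ βʸ` lies in the `n`-th
cyclotomic field. -/
noncomputable def cycExponents (n i : ℕ) (α β : ℂ) : Finset (ℕ × ℕ) :=
  (Finset.range n ×ˢ Finset.range i).filter fun p => α ^ p.1 * β ^ p.2 ∈ cycField n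

theorem mem_cycExponents {n i : ℕ} {α β : ℂ} {p : ℕ × ℕ} :
    p ∈ cycExponents n i α β ↔ (p.1 < n ∧ p.2 < i) ∧ α ^ p.1 * β ^ p.2 ∈ cycField n := by
  simp [cycExponents]

/-- The tower through `K = ℚ(ζ)` splits off the factor `φ(ij)`; the Kummer count over `K`, with `ζ ^
j` as the primitive `i`-th root of unity, handles the rest. -/
theorem degreeLoss_eq_card_cycExponents {a b : ℚˣ} {i j : ℕ} (hi : i ≠ 0) (hj : j ≠ 0)
    {ζ α β : ℂ} (hζ : IsPrimitiveRoot ζ (i * j)) (hα : α ^ (i * j) = ((a : ℚ) : ℂ))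
    (hβ : β ^ i = ((b : ℚ) : ℂ)) :
    degreeLoss i j ζ α β = (cycExponents (i * j) i α β).card := by
  classical
  have hn : i * j ≠ 0 := mul_ne_zero hi hj
  have : NeZero (i * j) := ⟨hn⟩
  set K := IntermediateField.adjoin ℚ {ζ} with hK
  have hKcyc : cycField (i * j) = K := cycField_eq_adjoin hn hζ
  have hcyc : IsCyclotomicExtension {i * j} ℚ K := hKcyc ▸ isCyclotomicExtension_cycField (i * j)
  have hα0 : α ≠ 0 := by
    rintro rfl
    rw [zero_pow hn] at hα
    exact a.ne_zero (by exact_mod_cast hα.symm)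
  have hβ0 : β ≠ 0 := by
    rintro rfl
    rw [zero_pow hi] at hβ
    exact b.ne_zero (by exact_mod_cast hβ.symm)
  have hζK : IsPrimitiveRoot (⟨ζ, IntermediateField.mem_adjoin_simple_self ℚ ζ⟩ : K) (i * j) := by
    rwa [← IsPrimitiveRoot.coe_submonoidClass_iff]
  have key := card_filter_mem_mul_finrank_adjoin_pair (F := K) (M := ℂ) hn hi hζK
    (hζK.pow (Nat.pos_of_ne_zero hn) (mul_comm i j)) hα0 hβ0
    (r := algebraMap ℚ K a) (t := algebraMap ℚ K b) hα hβ
  have hfilter : ((Finset.range (i * j) ×ˢ Finset.range i).filter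
      fun p => α ^ p.1 * β ^ p.2 ∈ Set.range (algebraMap K ℂ)) = cycExponents (i * j) i α β := by
    rw [cycExponents]
    refine Finset.filter_congr fun p _ => ?_
    rw [hKcyc]
    exact ⟨fun ⟨z, hz⟩ => hz ▸ z.2, fun h => ⟨⟨_, h⟩, rfl⟩⟩
  rw [hfilter] at key
  have hfin : Module.finrank ℚ (IntermediateField.adjoin ℚ ({ζ, α, β} : Set ℂ)) =
      Nat.totient (i * j) * Module.finrank K (IntermediateField.adjoin K {α, β}) := by
    rw [← IsCyclotomicExtension.Rat.finrank (i * j) K, Module.finrank_mul_finrank,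
      ← Set.singleton_union, ← IntermediateField.adjoin_adjoin_left]
    rfl
  have hφ : (Nat.totient (i * j) : ℚ) ≠ 0 := by
    exact_mod_cast (Nat.totient_pos.2 (Nat.pos_of_ne_zero hn)).ne'
  have hpos : (Module.finrank K (IntermediateField.adjoin K {α, β}) : ℚ) ≠ 0 := by
    intro h
    have h : Module.finrank K (IntermediateField.adjoin K {α, β}) = 0 := by exact_mod_cast h
    rw [h, mul_zero] at key
    exact mul_ne_zero hn hi key.symm
  rw [degreeLoss, hfin, div_eq_iff (by push_cast; exact mul_ne_zero hφ hpos)]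
  have key' : ((cycExponents (i * j) i α β).card : ℚ) *
      Module.finrank K (IntermediateField.adjoin K {α, β}) = i * j * i := by exact_mod_cast key
  push_cast
  linear_combination -(Nat.totient (i * j) : ℚ) * key'

/-! ### The count divides `4t` -/

section

variable {a b : ℚˣ} {i j : ℕ} {α β : ℂ}

theorem exists_unit_eq_normSq (hi : i ≠ 0) (hj : j ≠ 0) (hα : α ^ (i * j) = ((a : ℚ) : ℂ))
    (hβ : β ^ i = ((b : ℚ) : ℂ)) {x y : ℤ} (h : α ^ x * β ^ y ∈ cycField (i * j)) :
    ∃ ρ : ℚˣ, ((ρ : ℚ) : ℝ) = Complex.normSq α ^ x * Complex.normSq β ^ y := by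
  have hn : i * j ≠ 0 := mul_ne_zero hi hj
  have hα0 : α ≠ 0 := by
    rintro rfl
    rw [zero_pow hn] at hα
    exact a.ne_zero (by exact_mod_cast hα.symm)
  have hβ0 : β ≠ 0 := by
    rintro rfl
    rw [zero_pow hi] at hβ
    exact b.ne_zero (by exact_mod_cast hβ.symm)
  have hpow : (α ^ x * β ^ y) ^ (i * j) = (((a : ℚ) ^ x * ((b : ℚ) ^ j) ^ y : ℚ) : ℂ) := by
    push_cast
    rw [← hα, ← hβ, mul_pow, ← pow_mul, ← zpow_natCast, ← zpow_natCast, ← zpow_natCast,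
      ← zpow_natCast, zpow_comm, zpow_comm β]
  obtain ⟨ρ, hρ⟩ := exists_normSq_eq_ratCast hn hn h hpow
  have h0 : ρ ≠ 0 := by
    rintro rfl
    rw [Rat.cast_zero, Complex.normSq_eq_zero] at hρ
    exact mul_ne_zero (zpow_ne_zero x hα0) (zpow_ne_zero y hβ0) hρ
  exact ⟨Units.mk0 ρ h0, by rw [Units.val_mk0, ← hρ, map_mul, map_zpow₀, map_zpow₀]⟩

theorem pow_eq_of_eq_normSq (hα : α ^ (i * j) = ((a : ℚ) : ℂ))
    (hβ : β ^ i = ((b : ℚ) : ℂ)) {x y : ℤ} {ρ : ℚˣ}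
    (h : ((ρ : ℚ) : ℝ) = Complex.normSq α ^ x * Complex.normSq β ^ y) :
    ρ ^ (i * j) = a ^ (2 * x) * b ^ (2 * j * y) := by
  have hA : Complex.normSq α ^ (i * j) = ((a : ℚ) : ℝ) ^ 2 := by
    rw [← map_pow, hα, ← Complex.ofReal_ratCast, Complex.normSq_ofReal, sq]
  have hB : Complex.normSq β ^ i = ((b : ℚ) : ℝ) ^ 2 := by
    rw [← map_pow, hβ, ← Complex.ofReal_ratCast, Complex.normSq_ofReal, sq]
  have hR : ((ρ : ℚ) : ℝ) ^ (i * j) = ((a : ℚ) : ℝ) ^ (2 * x) * ((b : ℚ) : ℝ) ^ (2 * j * y) := by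
    have h1 : Complex.normSq β ^ (i * j) = ((b : ℚ) : ℝ) ^ (2 * j) := by rw [pow_mul, hB, pow_mul]
    rw [h, mul_pow, ← zpow_natCast, ← zpow_natCast, zpow_comm, zpow_comm (Complex.normSq β),
      zpow_natCast, zpow_natCast, hA, h1, zpow_mul, zpow_mul]
    norm_cast
  apply Units.ext
  push_cast
  exact_mod_cast hR

/-- Writing `ρ = ±aᵘ bᵛ` and squaring away the sign, two expressions for `ρ ^ (2ij)` are compared;
independence gives `2x = iju` and `2y = iv`. -/
theorem dvd_two_mul_of_mem_closure (hab : MultIndep a b) (hj : j ≠ 0)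
    (hα : α ^ (i * j) = ((a : ℚ) : ℂ)) (hβ : β ^ i = ((b : ℚ) : ℂ)) {x y : ℤ} {ρ : ℚˣ}
    (h : ((ρ : ℚ) : ℝ) = Complex.normSq α ^ x * Complex.normSq β ^ y)
    (hρ : ρ ∈ Subgroup.closure ({-1, a, b} : Set ℚˣ)) :
    ((i * j : ℕ) : ℤ) ∣ 2 * x ∧ (i : ℤ) ∣ 2 * y := by
  have h1 := pow_eq_of_eq_normSq hα hβ h
  obtain ⟨u, v, huv⟩ := mem_closure_neg_one_pair.1 hρ
  have h2 : ρ ^ 2 = a ^ (2 * u) * b ^ (2 * v) := by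
    have : (a ^ u * b ^ v) ^ 2 = a ^ (2 * u) * b ^ (2 * v) := by
      rw [mul_pow, mul_comm 2 u, mul_comm 2 v, zpow_mul, zpow_mul]
      norm_cast
    rcases huv with rfl | rfl
    · exact this
    · rw [neg_sq, this]
  have h3 : a ^ (2 * u * (i * j : ℕ) - 2 * x * 2) * b ^ (2 * v * (i * j : ℕ) - 2 * j * y * 2) = 1 := by
    have h4 : (ρ ^ 2) ^ (i * j) = (ρ ^ (i * j)) ^ 2 := pow_right_comm ρ 2 (i * j)
    rw [h1, h2, mul_pow, mul_pow, ← zpow_natCast, ← zpow_natCast, ← zpow_natCast, ← zpow_natCast,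
      ← zpow_mul, ← zpow_mul, ← zpow_mul, ← zpow_mul] at h4
    rw [zpow_sub, zpow_sub, mul_mul_mul_comm, h4, ← mul_inv]
    exact mul_inv_cancel _
  obtain ⟨h5, h6⟩ := hab _ _ h3
  refine ⟨⟨u, by linarith⟩, v, ?_⟩
  have hj' : (j : ℤ) ≠ 0 := by exact_mod_cast hj
  apply mul_left_cancel₀ hj'
  push_cast at h6
  linarith

end

/-- The homomorphism `(x, y) ↦ uˣ vʸ`, for `uⁿ = vⁱ = 1`. -/
noncomputable def zpowPairHom {G : Type*} [CommGroup G] {n i : ℕ} {u v : G} (hu : u ^ n = 1)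
    (hv : v ^ i = 1) : ZMod n × ZMod i →+ Additive G :=
  (ZMod.lift n ⟨zmultiplesHom _ (Additive.ofMul u), by
      rw [zmultiplesHom_apply, natCast_zsmul, ← ofMul_pow, hu, ofMul_one]⟩).coprod
    (ZMod.lift i ⟨zmultiplesHom _ (Additive.ofMul v), by
      rw [zmultiplesHom_apply, natCast_zsmul, ← ofMul_pow, hv, ofMul_one]⟩)

theorem zpowPairHom_intCast {G : Type*} [CommGroup G] {n i : ℕ} {u v : G} (hu : u ^ n = 1)
    (hv : v ^ i = 1) (x y : ℤ) :
    zpowPairHom hu hv ((x : ZMod n), (y : ZMod i)) = Additive.ofMul (u ^ x * v ^ y) := by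
  rw [zpowPairHom, AddMonoidHom.coprod_apply, ZMod.lift_coe, ZMod.lift_coe]
  rfl

/-- The nonzero elements of a subfield of `ℂ`. -/
def unitSubgroup (K : IntermediateField ℚ ℂ) : Subgroup ℂˣ where
  carrier := {u | (u : ℂ) ∈ K}
  one_mem' := one_mem K
  mul_mem' h1 h2 := K.mul_mem h1 h2
  inv_mem' h := by
    change ((_ : ℂˣ)⁻¹ : ℂˣ).val ∈ K
    rw [Units.val_inv_eq_inv_val]
    exact inv_mem h

theorem card_two_torsion_zmod_prod_dvd (n i : ℕ) [NeZero n] [NeZero i]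
    (V : AddSubgroup (ZMod n × ZMod i)) (hV : ∀ p ∈ V, 2 • p = 0) : Nat.card V ∣ 4 := by
  have hker : ∀ m : ℕ, [NeZero m] → Nat.card (nsmulAddMonoidHom (α := ZMod m) 2).ker ∣ 2 := fun m _ => by
    rw [IsAddCyclic.card_nsmulAddMonoidHom_ker]
    exact Nat.gcd_dvd_right _ _
  have hle : V ≤ (nsmulAddMonoidHom (α := ZMod n) 2).ker.prod (nsmulAddMonoidHom (α := ZMod i) 2).ker :=
    fun p hp => ⟨congrArg Prod.fst (hV p hp), congrArg Prod.snd (hV p hp)⟩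
  refine (AddSubgroup.card_dvd_of_le hle).trans ?_
  rw [Nat.card_congr (AddSubgroup.prodEquiv _ _).toEquiv, Nat.card_prod]
  exact mul_dvd_mul (hker n) (hker i)

/-- The order of `H` is the order of the kernel of `ν` on `H` times that of its image, which lies in
`T`. -/
theorem card_dvd_card_mul_card_ker {A B : Type*} [AddGroup A] [AddGroup B] [Finite A] (H : AddSubgroup A)
    (ν : A →+ B) (T : AddSubgroup B) (hT : ∀ p ∈ H, ν p ∈ T) :
    Nat.card H ∣ Nat.card (H ⊓ ν.ker : AddSubgroup A) * Nat.card T := by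
  have h1 := AddSubgroup.card_mul_index (ν.comp H.subtype).ker
  rw [AddSubgroup.index_ker] at h1
  have h2 : Nat.card (ν.comp H.subtype).ker = Nat.card (H ⊓ ν.ker : AddSubgroup A) := by
    refine Nat.card_congr ⟨fun p => ⟨p.1.1, p.1.2, p.2⟩, fun p => ⟨⟨p.1, p.2.1⟩, p.2.2⟩,
      fun _ => rfl, fun _ => rfl⟩
  rw [← h1, h2]
  refine mul_dvd_mul_left _ (AddSubgroup.card_dvd_of_le ?_)
  rintro _ ⟨p, rfl⟩
  exact hT p.1 p.2

section

variable {a b : ℚˣ} {i j : ℕ} {α β : ℂ}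

theorem card_cycExponents_dvd (hab : MultIndep a b) (hi : i ≠ 0) (hj : j ≠ 0)
    (hα : α ^ (i * j) = ((a : ℚ) : ℂ)) (hβ : β ^ i = ((b : ℚ) : ℂ)) :
    (cycExponents (i * j) i α β).card ∣ 4 * torsionOrder a b := by
  have hn : i * j ≠ 0 := mul_ne_zero hi hj
  have : NeZero (i * j) := ⟨hn⟩
  have : NeZero i := ⟨hi⟩
  have hα0 : α ≠ 0 := by
    rintro rfl
    rw [zero_pow hn] at hα
    exact a.ne_zero (by exact_mod_cast hα.symm)
  have hβ0 : β ≠ 0 := by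
    rintro rfl
    rw [zero_pow hi] at hβ
    exact b.ne_zero (by exact_mod_cast hβ.symm)
  set α' := Units.mk0 α hα0
  set β' := Units.mk0 β hβ0
  set W := Subgroup.closure ({-1, a, b} : Set ℚˣ) with hW
  set ι : ℚˣ →* ℝˣ := Units.map (Rat.castHom ℝ : ℚ →* ℝ) with hι
  have hιinj : Function.Injective ι := Units.map_injective (Rat.castHom ℝ).injective
  set N : ℂˣ →* ℝˣ := Units.map (Complex.normSq : ℂ →* ℝ) with hN
  have hWa : a ∈ W := Subgroup.subset_closure (by simp)
  have hWb : b ∈ W := Subgroup.subset_closure (by simp)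
  have hα1 : (QuotientGroup.mk α' : ℂˣ ⧸ unitSubgroup (cycField (i * j))) ^ (i * j) = 1 := by
    rw [← QuotientGroup.mk_pow, QuotientGroup.eq_one_iff]
    change α ^ (i * j) ∈ cycField (i * j)
    exact hα ▸ (cycField (i * j)).algebraMap_mem a
  have hβ1 : (QuotientGroup.mk β' : ℂˣ ⧸ unitSubgroup (cycField (i * j))) ^ i = 1 := by
    rw [← QuotientGroup.mk_pow, QuotientGroup.eq_one_iff]
    change β ^ i ∈ cycField (i * j)
    exact hβ ▸ (cycField (i * j)).algebraMap_mem b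
  have hα2 : (QuotientGroup.mk (N α') : ℝˣ ⧸ W.map ι) ^ (i * j) = 1 := by
    rw [← QuotientGroup.mk_pow, QuotientGroup.eq_one_iff]
    refine ⟨a ^ 2, pow_mem hWa 2, Units.ext ?_⟩
    change (((a : ℚ) ^ 2 : ℚ) : ℝ) = Complex.normSq α ^ (i * j)
    rw [← map_pow, hα, ← Complex.ofReal_ratCast, Complex.normSq_ofReal]
    push_cast; ring
  have hβ2 : (QuotientGroup.mk (N β') : ℝˣ ⧸ W.map ι) ^ i = 1 := by
    rw [← QuotientGroup.mk_pow, QuotientGroup.eq_one_iff]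
    refine ⟨b ^ 2, pow_mem hWb 2, Units.ext ?_⟩
    change (((b : ℚ) ^ 2 : ℚ) : ℝ) = Complex.normSq β ^ i
    rw [← map_pow, hβ, ← Complex.ofReal_ratCast, Complex.normSq_ofReal]
    push_cast; ring
  -- The kernel of `θ` is the group of counted exponents. The map `ν` takes the squared absolute
  -- value of a monomial modulo `⟨-1, a, b⟩`; it must be defined in `ℝˣ`, since rationality holds
  -- only on the kernel of `θ`.
  set θ := zpowPairHom (G := ℂˣ ⧸ unitSubgroup (cycField (i * j))) hα1 hβ1 with hθ
  set ν := zpowPairHom (G := ℝˣ ⧸ W.map ι) hα2 hβ2 with hν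
  have hθker : ∀ x y : ℤ, ((x : ZMod (i * j)), (y : ZMod i)) ∈ θ.ker ↔
      α ^ x * β ^ y ∈ cycField (i * j) := fun x y => by
    rw [AddMonoidHom.mem_ker, hθ, zpowPairHom_intCast, ofMul_eq_zero, ← QuotientGroup.mk_zpow,
      ← QuotientGroup.mk_zpow, ← QuotientGroup.mk_mul, QuotientGroup.eq_one_iff]
    change ((α' ^ x * β' ^ y : ℂˣ) : ℂ) ∈ cycField (i * j) ↔ _
    rw [Units.val_mul, Units.val_zpow_eq_zpow_val, Units.val_zpow_eq_zpow_val]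
    rfl
  have hνρ : ∀ x y : ℤ, α ^ x * β ^ y ∈ cycField (i * j) → ∃ ρ : ℚˣ,
      ((ρ : ℚ) : ℝ) = Complex.normSq α ^ x * Complex.normSq β ^ y ∧
      ν ((x : ZMod (i * j)), (y : ZMod i)) = Additive.ofMul (QuotientGroup.mk (ι ρ)) :=
    fun x y hxy => by
      obtain ⟨ρ, hρ⟩ := exists_unit_eq_normSq hi hj hα hβ hxy
      refine ⟨ρ, hρ, ?_⟩
      rw [hν, zpowPairHom_intCast, ← QuotientGroup.mk_zpow, ← QuotientGroup.mk_zpow,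
        ← QuotientGroup.mk_mul]
      congr 2
      apply Units.ext
      rw [Units.val_mul, Units.val_zpow_eq_zpow_val, Units.val_zpow_eq_zpow_val]
      exact hρ.symm
  -- This embedding of the factor group allows the image of `ν` to be compared with the torsion
  -- subgroup.
  set κ : FactorGroup a b →* ℝˣ ⧸ W.map ι :=
    QuotientGroup.map W (W.map ι) ι (Subgroup.le_comap_map ι W) with hκ
  have hκinj : Function.Injective κ := by
    rw [injective_iff_map_eq_one]
    intro q
    induction q using QuotientGroup.induction_on with
    | H r =>
    intro h
    rw [hκ, QuotientGroup.map_mk, QuotientGroup.eq_one_iff] at h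
    obtain ⟨w, hw, hwr⟩ := h
    rw [QuotientGroup.eq_one_iff]
    exact hιinj hwr ▸ hw
  have hcard : (cycExponents (i * j) i α β).card = Nat.card θ.ker := by
    have hmem : ∀ p : ℕ × ℕ, ((p.1 : ZMod (i * j)), (p.2 : ZMod i)) ∈ θ.ker ↔
        α ^ p.1 * β ^ p.2 ∈ cycField (i * j) := fun p => by
      simpa using hθker p.1 p.2
    rw [← Nat.card_eq_finsetCard]
    refine Nat.card_eq_of_bijective (fun p : cycExponents (i * j) i α β =>
      (⟨((p.1.1 : ZMod (i * j)), (p.1.2 : ZMod i)), (hmem p.1).2 (mem_cycExponents.1 p.2).2⟩ :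
        θ.ker)) ⟨?_, ?_⟩
    · rintro ⟨p, hp⟩ ⟨q, hq⟩ hpq
      rw [mem_cycExponents] at hp hq
      simp only [Subtype.mk.injEq, Prod.mk.injEq] at hpq
      have h1 := congrArg ZMod.val hpq.1
      have h2 := congrArg ZMod.val hpq.2
      rw [ZMod.val_natCast_of_lt hp.1.1, ZMod.val_natCast_of_lt hq.1.1] at h1
      rw [ZMod.val_natCast_of_lt hp.1.2, ZMod.val_natCast_of_lt hq.1.2] at h2
      exact Subtype.ext (Prod.ext h1 h2)
    · rintro ⟨⟨x, y⟩, hxy⟩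
      have hcast : (((x.val : ℕ) : ZMod (i * j)), ((y.val : ℕ) : ZMod i)) = (x, y) := by simp
      refine ⟨⟨(x.val, y.val), ?_⟩, Subtype.ext hcast⟩
      refine mem_cycExponents.2 ⟨⟨x.val_lt, y.val_lt⟩, (hmem (x.val, y.val)).1 ?_⟩
      rw [hcast]
      exact hxy
  have hsurj : ∀ p : ZMod (i * j) × ZMod i, ∃ x y : ℤ, p = ((x : ZMod (i * j)), (y : ZMod i)) :=
    fun p => by
      obtain ⟨x, hx⟩ := ZMod.intCast_surjective p.1
      obtain ⟨y, hy⟩ := ZMod.intCast_surjective p.2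
      exact ⟨x, y, by rw [hx, hy]⟩
  rw [hcard]
  refine (card_dvd_card_mul_card_ker θ.ker ν ((torsionSubgroup a b).map κ).toAddSubgroup ?_).trans
    (mul_dvd_mul ?_ ?_)
  · intro p hp
    obtain ⟨x, y, rfl⟩ := hsurj p
    obtain ⟨ρ, hρ, hνp⟩ := hνρ x y ((hθker x y).1 hp)
    rw [hνp]
    refine ⟨QuotientGroup.mk ρ, mk_mem_torsionSubgroup.2 ⟨i * j, Nat.pos_of_ne_zero hn, ?_⟩, rfl⟩
    rw [pow_eq_of_eq_normSq hα hβ hρ]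
    exact mul_mem (zpow_mem hWa _) (zpow_mem hWb _)
  · refine card_two_torsion_zmod_prod_dvd _ _ _ ?_
    rintro p ⟨hp, hpν⟩
    obtain ⟨x, y, rfl⟩ := hsurj p
    obtain ⟨ρ, hρ, hνp⟩ := hνρ x y ((hθker x y).1 hp)
    have hρW : ρ ∈ W := by
      have h : ν ((x : ZMod (i * j)), (y : ZMod i)) = 0 := hpν
      rw [hνp, ofMul_eq_zero, QuotientGroup.eq_one_iff] at h
      obtain ⟨w, hw, hwr⟩ := h
      exact hιinj hwr ▸ hw
    obtain ⟨h1, h2⟩ := dvd_two_mul_of_mem_closure hab hj hα hβ hρ hρW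
    rw [← ZMod.intCast_zmod_eq_zero_iff_dvd] at h1 h2
    ext
    · simpa [two_mul, two_nsmul] using h1
    · simpa [two_mul, two_nsmul] using h2
  · have : Nat.card ((torsionSubgroup a b).map κ).toAddSubgroup = torsionOrder a b :=
      Nat.card_congr ((torsionSubgroup a b).equivMapOfInjective κ hκinj).toEquiv.symm
    rw [this]

end

/-! ### Exact values when `t = 1` -/

theorem quadDisc_mul_isSquare (x : ℚˣ) : ∃ s : ℚ, (quadDisc x : ℚ) * x = s ^ 2 := by
  obtain ⟨d, q, -, -, hx, ⟨-, h⟩ | ⟨-, h⟩⟩ := exists_quadDisc_eq x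
  · exact ⟨d * q, by rw [h, hx]; ring⟩
  · exact ⟨2 * d * q, by rw [h, hx]; push_cast; ring⟩

theorem isSquare_of_quadDisc_eq_one {x : ℚˣ} (h : quadDisc x = 1) : IsSquare x := by
  obtain ⟨s, hs⟩ := quadDisc_mul_isSquare x
  rw [h, Int.cast_one, one_mul] at hs
  have hs0 : s ≠ 0 := by rintro rfl; exact by simp at hs
  exact ⟨Units.mk0 s hs0, Units.ext (by simpa [sq] using hs)⟩

theorem isSquare_mul_of_quadDisc_eq {x y : ℚˣ} (h : quadDisc x = quadDisc y) : IsSquare (x * y) := by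
  obtain ⟨s, hs⟩ := quadDisc_mul_isSquare x
  obtain ⟨t, ht⟩ := quadDisc_mul_isSquare y
  have hD : (quadDisc y : ℚ) ≠ 0 := by exact_mod_cast NumberField.discr_ne_zero (sqrtField y)
  rw [h] at hs
  have hxy : (x : ℚ) * y = (s * t / quadDisc y) ^ 2 := by
    rw [div_pow, mul_pow, ← hs, ← ht]
    field_simp
  have h0 : s * t / quadDisc y ≠ 0 := fun h0 => by
    rw [h0] at hxy
    simp at hxy
  exact ⟨Units.mk0 _ h0, Units.ext (by simpa [sq] using hxy)⟩

theorem mem_closure_of_torsionOrder_eq_one {a b r : ℚˣ} (ht : torsionOrder a b = 1) {m : ℕ}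
    (hm : m ≠ 0) (hr : r ^ m ∈ Subgroup.closure ({-1, a, b} : Set ℚˣ)) :
    r ∈ Subgroup.closure ({-1, a, b} : Set ℚˣ) := by
  have h1 := (mk_mem_torsionSubgroup (a := a) (b := b)).2 ⟨m, Nat.pos_of_ne_zero hm, hr⟩
  rw [Subgroup.card_eq_one.1 ht, Subgroup.mem_bot, QuotientGroup.eq_one_iff] at h1
  exact h1

/-- A square root of `aˣ bʸ` is torsion in the factor group, so it lies in `⟨-1, a, b⟩`;
independence then halves the exponents. This keeps the discriminants in the counts distinct. -/
theorem even_of_isSquare {a b : ℚˣ} (hab : MultIndep a b) (ht : torsionOrder a b = 1) {x y : ℤ}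
    (h : IsSquare (a ^ x * b ^ y)) : Even x ∧ Even y := by
  obtain ⟨s, hs⟩ := h
  have hsW : s ∈ Subgroup.closure ({-1, a, b} : Set ℚˣ) := by
    refine mem_closure_of_torsionOrder_eq_one ht two_ne_zero ?_
    rw [sq, ← hs]
    exact mem_closure_neg_one_pair.2 ⟨x, y, Or.inl rfl⟩
  obtain ⟨u, v, huv⟩ := mem_closure_neg_one_pair.1 hsW
  have h2 : a ^ x * b ^ y = a ^ (u + u) * b ^ (v + v) := by
    rw [hs, zpow_add, zpow_add, mul_mul_mul_comm]
    rcases huv with rfl | rfl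
    · rfl
    · rw [neg_mul_neg]
  obtain ⟨h3, h4⟩ := hab (x - (u + u)) (y - (v + v)) (by
    rw [zpow_sub, zpow_sub, mul_mul_mul_comm, h2, ← mul_inv]
    exact mul_inv_cancel _)
  exact ⟨⟨u, by omega⟩, v, by omega⟩

theorem mem_cycField_iff_quadDisc_dvd {n : ℕ} (hn : n ≠ 0) {z : ℂ} {x : ℚˣ}
    (hz : z ^ 2 = ((x : ℚ) : ℂ)) : z ∈ cycField n ↔ quadDisc x ∣ n := by
  rw [← hasCycSqrt_iff_quadDisc_dvd hn]
  refine ⟨fun h => ⟨z, h, hz⟩, ?_⟩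
  rintro ⟨w, hw, h⟩
  rw [← hz, sq_eq_sq_iff_eq_or_eq_neg] at h
  rcases h with rfl | rfl
  · exact hw
  · exact (neg_mem_iff).1 hw

section

variable {a b : ℚˣ} {i j : ℕ} {α β : ℂ}

/-- Without torsion the squared absolute value always lies in `⟨-1, a, b⟩`, so every counted
exponent is 2-torsion. -/
theorem dvd_two_mul_of_mem_cycExponents (hab : MultIndep a b) (ht : torsionOrder a b = 1)
    (hi : i ≠ 0) (hj : j ≠ 0) (hα : α ^ (i * j) = ((a : ℚ) : ℂ)) (hβ : β ^ i = ((b : ℚ) : ℂ))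
    {p : ℕ × ℕ} (hp : p ∈ cycExponents (i * j) i α β) : i * j ∣ 2 * p.1 ∧ i ∣ 2 * p.2 := by
  obtain ⟨ρ, hρ⟩ := exists_unit_eq_normSq (x := p.1) (y := p.2) hi hj hα hβ
    (by simpa using (mem_cycExponents.1 hp).2)
  have hρW : ρ ∈ Subgroup.closure ({-1, a, b} : Set ℚˣ) := by
    refine mem_closure_of_torsionOrder_eq_one ht (mul_ne_zero hi hj) ?_
    rw [pow_eq_of_eq_normSq hα hβ hρ]
    exact mem_closure_neg_one_pair.2 ⟨_, _, Or.inl rfl⟩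
  have := dvd_two_mul_of_mem_closure hab hj hα hβ hρ hρW
  exact_mod_cast this

theorem card_cycExponents_of_even (hab : MultIndep a b) (ht : torsionOrder a b = 1)
    (hi : i ≠ 0) (hj : j ≠ 0) (hα : α ^ (i * j) = ((a : ℚ) : ℂ)) (hβ : β ^ i = ((b : ℚ) : ℂ))
    (hi2 : Even i) : (cycExponents (i * j) i α β).card =
      (({1, quadDisc a, quadDisc b, quadDisc (a * b)} : Finset ℤ).filter
        (fun d => d ∣ ((i * j : ℕ) : ℤ))).card := by
  classical
  obtain ⟨k, hk⟩ := hi2.two_dvd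
  have hk0 : k ≠ 0 := by rintro rfl; exact hi (by simpa using hk)
  have hn : i * j ≠ 0 := mul_ne_zero hi hj
  have hkj : k * j ≠ 0 := mul_ne_zero hk0 hj
  have hnk : i * j = 2 * (k * j) := by rw [hk, mul_assoc]
  have hodd : ∀ {x y : ℤ}, ¬ (Even x ∧ Even y) → ¬ IsSquare (a ^ x * b ^ y) :=
    fun h hs => h (even_of_isSquare hab ht hs)
  have e1 : (1 : ℤ) ≠ quadDisc a := fun h => by
    have := isSquare_of_quadDisc_eq_one h.symm
    exact hodd (x := 1) (y := 0) (by decide) (by simpa using this)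
  have e2 : (1 : ℤ) ≠ quadDisc b := fun h => by
    have := isSquare_of_quadDisc_eq_one h.symm
    exact hodd (x := 0) (y := 1) (by decide) (by simpa using this)
  have e3 : (1 : ℤ) ≠ quadDisc (a * b) := fun h => by
    have := isSquare_of_quadDisc_eq_one h.symm
    exact hodd (x := 1) (y := 1) (by decide) (by simpa using this)
  have e4 : quadDisc a ≠ quadDisc b := fun h => by
    have := isSquare_mul_of_quadDisc_eq h
    exact hodd (x := 1) (y := 1) (by decide) (by simpa using this)
  have e5 : quadDisc a ≠ quadDisc (a * b) := fun h => by
    have := isSquare_mul_of_quadDisc_eq h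
    rw [← mul_assoc, ← sq] at this
    exact hodd (x := 2) (y := 1) (by decide) (by simpa using this)
  have e6 : quadDisc b ≠ quadDisc (a * b) := fun h => by
    have := isSquare_mul_of_quadDisc_eq h
    rw [mul_left_comm, ← sq] at this
    exact hodd (x := 1) (y := 2) (by decide) (by simpa using this)
  -- With `i = 2k`, the 2-torsion of `ℤ/ij × ℤ/i` has these four representatives; the monomials are
  -- 1 and square roots of `a`, `b`, `ab`.
  have hset : cycExponents (i * j) i α β =
      ({(0, 0), (k * j, 0), (0, k), (k * j, k)} : Finset (ℕ × ℕ)).filter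
        fun p => α ^ p.1 * β ^ p.2 ∈ cycField (i * j) := by
    ext ⟨x, y⟩
    rw [Finset.mem_filter]
    constructor
    · intro h
      obtain ⟨⟨u, hu⟩, v, hv⟩ := dvd_two_mul_of_mem_cycExponents hab ht hi hj hα hβ h
      obtain ⟨⟨hx, hy⟩, hmem⟩ := mem_cycExponents.1 h
      refine ⟨?_, hmem⟩
      simp only at hu hv hx hy
      rw [hnk] at hu hx
      rw [hk] at hv hy
      have hu' : x = k * j * u := by nlinarith
      have hv' : y = k * v := by nlinarith
      have hu2 : u < 2 := by
        by_contra hc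
        have := Nat.mul_le_mul_left (k * j) (not_lt.1 hc)
        omega
      have hv2 : v < 2 := by
        by_contra hc
        have := Nat.mul_le_mul_left k (not_lt.1 hc)
        omega
      subst hu' hv'
      interval_cases u <;> interval_cases v <;> simp
    · rintro ⟨h, hmem⟩
      refine mem_cycExponents.2 ⟨?_, hmem⟩
      simp only [Finset.mem_insert, Finset.mem_singleton, Prod.mk.injEq] at h
      have h1 := Nat.pos_of_ne_zero hkj
      have h2 := Nat.pos_of_ne_zero hk0
      simp only
      omega
  have hA : α ^ (k * j) ∈ cycField (i * j) ↔ quadDisc a ∣ ((i * j : ℕ) : ℤ) :=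
    mem_cycField_iff_quadDisc_dvd hn (by rw [← pow_mul, mul_comm _ 2, ← hnk, hα])
  have hB : β ^ k ∈ cycField (i * j) ↔ quadDisc b ∣ ((i * j : ℕ) : ℤ) :=
    mem_cycField_iff_quadDisc_dvd hn (by rw [← pow_mul, mul_comm _ 2, ← hk, hβ])
  have hAB : α ^ (k * j) * β ^ k ∈ cycField (i * j) ↔ quadDisc (a * b) ∣ ((i * j : ℕ) : ℤ) :=
    mem_cycField_iff_quadDisc_dvd hn (by
      rw [mul_pow, ← pow_mul, ← pow_mul, mul_comm _ 2, mul_comm _ 2, ← hnk, ← hk, hα, hβ]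
      push_cast; rfl)
  rw [hset, Finset.card_filter, Finset.card_filter, Finset.sum_insert, Finset.sum_insert,
    Finset.sum_insert, Finset.sum_singleton, Finset.sum_insert, Finset.sum_insert,
    Finset.sum_insert, Finset.sum_singleton]
  · simp only [pow_zero, mul_one, one_mul, hA, hB, hAB, one_mem, one_dvd]
  · simpa using e6
  · simp [e4, e5]
  · simp [e1, e2, e3]
  · simp [hkj.symm]
  · simp [hkj, hk0.symm]
  · simp [hkj.symm, hk0.symm]

/-- For odd `i`, `i ∣ 2y` leaves only `y = 0`, and `x = ij / 2` exists only for even `ij`. The lcm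
with 2 merges this parity condition with the condition that `√a` be cyclotomic. -/
theorem card_cycExponents_of_odd (hab : MultIndep a b) (ht : torsionOrder a b = 1)
    (hi : i ≠ 0) (hj : j ≠ 0) (hα : α ^ (i * j) = ((a : ℚ) : ℂ)) (hβ : β ^ i = ((b : ℚ) : ℂ))
    (hi2 : Odd i) : (cycExponents (i * j) i α β).card =
      (({1, ((Int.lcm 2 (quadDisc a) : ℕ) : ℤ)} : Finset ℤ).filter
        (fun d => d ∣ ((i * j : ℕ) : ℤ))).card := by
  classical
  have hn : i * j ≠ 0 := mul_ne_zero hi hj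
  have hne : (1 : ℤ) ≠ ((Int.lcm 2 (quadDisc a) : ℕ) : ℤ) := fun h => by
    have : (2 : ℤ) ∣ ((Int.lcm 2 (quadDisc a) : ℕ) : ℤ) := Int.dvd_lcm_left _ _
    rw [← h] at this
    omega
  have hzero : ∀ {p : ℕ × ℕ}, p ∈ cycExponents (i * j) i α β → p.2 = 0 := fun {p} hp => by
    have h1 := (dvd_two_mul_of_mem_cycExponents hab ht hi hj hα hβ hp).2
    have h2 : i ∣ p.2 := (Nat.Coprime.dvd_mul_left (Nat.coprime_two_right.2 hi2)).1 h1
    exact Nat.eq_zero_of_dvd_of_lt h2 (mem_cycExponents.1 hp).1.2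
  have hi0 := Nat.pos_of_ne_zero hi
  have hlcm : ((Int.lcm 2 (quadDisc a) : ℕ) : ℤ) ∣ ((i * j : ℕ) : ℤ) ↔
      2 ∣ i * j ∧ quadDisc a ∣ ((i * j : ℕ) : ℤ) := by
    rw [Int.coe_lcm_dvd_iff]
    norm_cast
  rw [Finset.card_filter, Finset.sum_pair hne, if_pos (one_dvd _)]
  by_cases h2 : 2 ∣ i * j
  · obtain ⟨k, hk⟩ := h2
    have hk0 : k ≠ 0 := by rintro rfl; exact hn (by simpa using hk)
    have hA : α ^ k ∈ cycField (i * j) ↔ quadDisc a ∣ ((i * j : ℕ) : ℤ) :=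
      mem_cycField_iff_quadDisc_dvd hn (by rw [← pow_mul, mul_comm _ 2, ← hk, hα])
    have hset : cycExponents (i * j) i α β =
        ({(0, 0), (k, 0)} : Finset (ℕ × ℕ)).filter
          fun p => α ^ p.1 * β ^ p.2 ∈ cycField (i * j) := by
      ext ⟨x, y⟩
      rw [Finset.mem_filter]
      constructor
      · intro h
        obtain ⟨⟨u, hu⟩, -⟩ := dvd_two_mul_of_mem_cycExponents hab ht hi hj hα hβ h
        obtain rfl : y = 0 := hzero h
        obtain ⟨⟨hx, -⟩, hmem⟩ := mem_cycExponents.1 h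
        refine ⟨?_, hmem⟩
        simp only at hu hx
        rw [hk] at hu hx
        have hu' : x = k * u := by nlinarith
        have hu2 : u < 2 := by
          by_contra hc
          have := Nat.mul_le_mul_left k (not_lt.1 hc)
          omega
        subst hu'
        interval_cases u <;> simp
      · rintro ⟨h, hmem⟩
        refine mem_cycExponents.2 ⟨?_, hmem⟩
        simp only [Finset.mem_insert, Finset.mem_singleton, Prod.mk.injEq] at h
        simp only
        omega
    rw [hset, Finset.card_filter, Finset.sum_pair (by simp [hk0.symm])]
    have h2' : 2 ∣ i * j := ⟨k, hk⟩
    simp only [pow_zero, mul_one, one_mem, if_true, hA, hlcm, h2', true_and]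
  · rw [if_neg (fun h => h2 (hlcm.1 h).1)]
    have hset : cycExponents (i * j) i α β = {(0, 0)} := by
      ext ⟨x, y⟩
      rw [Finset.mem_singleton]
      constructor
      · intro h
        obtain ⟨h1, -⟩ := dvd_two_mul_of_mem_cycExponents hab ht hi hj hα hβ h
        obtain rfl : y = 0 := hzero h
        have h3 : i * j ∣ x := (Nat.Coprime.dvd_mul_left
          (Nat.coprime_two_right.2 (by rw [← Nat.not_even_iff_odd, even_iff_two_dvd]; exact h2))).1 h1
        rw [Nat.eq_zero_of_dvd_of_lt h3 (mem_cycExponents.1 h).1.1]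
      · intro h
        rw [h]
        exact mem_cycExponents.2 ⟨⟨Nat.pos_of_ne_zero hn, hi0⟩, by simp⟩
    rw [hset, Finset.card_singleton]

end

end RadicalDegree

end

theorem mainTheorem3 (a b : ℚˣ) (hab : RadicalDegree.MultIndep a b) :
    Finite (RadicalDegree.torsionSubgroup a b) ∧
    ∀ i j : ℕ, 0 < i → 0 < j →
      ∀ ζ α β : ℂ, IsPrimitiveRoot ζ (i * j) →
        α ^ (i * j) = ((a : ℚ) : ℂ) → β ^ i = ((b : ℚ) : ℂ) →
        (∃ f : ℕ, 0 < f ∧ RadicalDegree.degreeLoss i j ζ α β = (f : ℚ) ∧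
          f ∣ 4 * RadicalDegree.torsionOrder a b) ∧
        (RadicalDegree.torsionOrder a b = 1 →
          (Even i → RadicalDegree.degreeLoss i j ζ α β =
            (((({1, RadicalDegree.quadDisc a, RadicalDegree.quadDisc b,
              RadicalDegree.quadDisc (a * b)} : Finset ℤ).filter
                (fun d => d ∣ ((i * j : ℕ) : ℤ))).card : ℕ) : ℚ)) ∧
          (Odd i → RadicalDegree.degreeLoss i j ζ α β =
            (((({1, ((Int.lcm 2 (RadicalDegree.quadDisc a) : ℕ) : ℤ)} : Finset ℤ).filter
                (fun d => d ∣ ((i * j : ℕ) : ℤ))).card : ℕ) : ℚ))) := by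
  refine ⟨RadicalDegree.finite_torsionSubgroup a b, fun i j hi hj ζ α β hζ hα hβ => ?_⟩
  have hloss := RadicalDegree.degreeLoss_eq_card_cycExponents hi.ne' hj.ne' hζ hα hβ
  refine ⟨⟨_, ?_, hloss, RadicalDegree.card_cycExponents_dvd hab hi.ne' hj.ne' hα hβ⟩,
    fun ht => ⟨fun hi2 => ?_, fun hi2 => ?_⟩⟩
  · exact Finset.card_pos.2 ⟨(0, 0), RadicalDegree.mem_cycExponents.2
      ⟨⟨Nat.mul_pos hi hj, hi⟩, by simp⟩⟩
  · rw [hloss, RadicalDegree.card_cycExponents_of_even hab ht hi.ne' hj.ne' hα hβ hi2]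
  · rw [hloss, RadicalDegree.card_cycExponents_of_odd hab ht hi.ne' hj.ne' hα hβ hi2]
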